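/- Let $\Delta=\operatorname{conv}\{\alpha(0),\alpha(1),\alpha(2)\}\subset\mathbb R^2$ be an even triangle, i.e. $\alpha(0),\alpha(1),\alpha(2)\in(2\mathbb N)^2$ are affinely independent. A set $L\subseteq\Delta\cap\mathbb Z^2$ is called mediated if it contains the vertices of $\Delta$ and every other point of $L$ is the average of two distinct points of $L\cap(2\mathbb Z)^2$; let $\Delta^*$ be the largest mediated set. $\Delta$ is an $H$-simplex if $\Delta^*=\Delta\cap\mathbb Z^2$. For $y\in\mathbb N^2$ in the interior of $\Delta$ let $P_\Delta^y$ be the set of circuit polynomials $\sum_{j=0}^2 b_j\mathbf x^{\alpha(j)}+c\,\mathbf x^y$ with $b_j>0$ and $c\in\mathbb R\setminus\{0\}$. Let $P_{2,2d}$ be the set of nonnegative real polynomials in two variables of degree at most $2d$, and $\Sigma_{2,2d}$ the subset of finite sums of squares of polynomials of degree at most $d$. 1. If $\tfrac12\Delta$ has at least four lattice points on its boundary, then $\Delta$ is an $H$-simplex, and consequently $P_{2,2d}\cap P_\Delta^y=\Sigma_{2,2d}\cap P_\Delta^y$ for all $d\in\mathbb N$ and all $y\in\mathbb N^2\cap\operatorname{int}\Delta$.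 2. Almost all even triangles are $H$-simplices: among the even triangles whose vertices $\alpha$ satisfy $\alpha_1+\alpha_2\le 2d$, the proportion of those that are $H$-simplices tends to $1$ as $d\to\infty$. 3. For almost all even triangles $\Delta$, in the same sense, nonnegative circuit polynomials on $\Delta$ are sums of squares: $P_{2,2e}\cap P_\Delta^y=\Sigma_{2,2e}\cap P_\Delta^y$ for all $e\in\mathbb N$ and all $y\in\mathbb N^2\cap\operatorname{int}\Delta$. -/

import Mathlib

open scoped Pointwise

/-- The inclusion of `ℤⁿ` in `ℝⁿ`. -/
def toReal {n : ℕ} (p : Fin n → ℤ) : Fin n → ℝ := fun i => (p i : ℝ)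

/-- An exponent vector in `ℕⁿ` regarded as a point of `ℤⁿ`. -/
def toInt {n : ℕ} (a : Fin n →₀ ℕ) : Fin n → ℤ := fun i => (a i : ℤ)

/-- The lattice points `S ∩ ℤⁿ` of a subset `S` of `ℝⁿ`. -/
def latticePoints {n : ℕ} (S : Set (Fin n → ℝ)) : Set (Fin n → ℤ) := {p | toReal p ∈ S}

/-- A lattice point is even if all its entries are even. -/
def IsEvenPoint {n : ℕ} (p : Fin n → ℤ) : Prop := ∀ i, Even (p i)

/-- `A(L)`: the lattice points that are averages of two even points of `L`. -/
def averages {n : ℕ} (L : Set (Fin n → ℤ)) : Set (Fin n → ℤ) :=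
  {β | ∃ s ∈ L, ∃ t ∈ L, IsEvenPoint s ∧ IsEvenPoint t ∧ 2 • β = s + t}

/-- The lattice points that are averages of two distinct even points of `L`. -/
def distinctAverages {n : ℕ} (L : Set (Fin n → ℤ)) : Set (Fin n → ℤ) :=
  {β | ∃ s ∈ L, ∃ t ∈ L, s ≠ t ∧ IsEvenPoint s ∧ IsEvenPoint t ∧ 2 • β = s + t}

/-- An even `n`-dimensional lattice simplex in `ℝⁿ` with vertices `α(0), …, α(n) ∈ (2ℕ)ⁿ`. -/
@[ext]
structure EvenSimplex (n : ℕ) where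
  vertex : Fin (n + 1) → Fin n →₀ ℕ
  even : ∀ j i, Even (vertex j i)
  affineIndependent : AffineIndependent ℝ (fun j => toReal (toInt (vertex j)))

namespace EvenSimplex

variable {n : ℕ} (Δ : EvenSimplex n)

/-- The vertex set as a set of lattice points. -/
def vertices : Set (Fin n → ℤ) := Set.range fun j => toInt (Δ.vertex j)

/-- The simplex as a subset of `ℝⁿ`: the convex hull of its vertices. -/
def carrier : Set (Fin n → ℝ) := convexHull ℝ (Set.range fun j => toReal (toInt (Δ.vertex j)))

/-- The lattice points on the boundary of `½Δ`. -/
def halfBoundaryPoints : Set (Fin n → ℤ) :=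
  latticePoints (frontier ((1 / 2 : ℝ) • Δ.carrier))

/-- `L ⊆ Δ ∩ ℤⁿ` is mediated: it contains the vertices of `Δ`, and each other point of `L` is
the average of two distinct even points of `L`. -/
def IsMediated (L : Set (Fin n → ℤ)) : Prop :=
  L ⊆ latticePoints Δ.carrier ∧ Δ.vertices ⊆ L ∧ L ⊆ distinctAverages L ∪ Δ.vertices

/-- The maximal mediated set `Δ*`: the union of all mediated sets. That it is mediated, hence the
largest mediated set, is proved in `isGreatest_maxMediated`. -/
def maxMediated : Set (Fin n → ℤ) := ⋃₀ {L | Δ.IsMediated L}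

/-- `Δ` is an `H`-simplex: `Δ* = Δ ∩ ℤⁿ`. -/
def IsHSimplex : Prop := Δ.maxMediated = latticePoints Δ.carrier

theorem distinctAverages_mono {L M : Set (Fin n → ℤ)} (h : L ⊆ M) :
    distinctAverages L ⊆ distinctAverages M := by
  rintro β ⟨s, hs, t, ht, r⟩
  exact ⟨s, h hs, t, h ht, r⟩

theorem isMediated_vertices : Δ.IsMediated Δ.vertices := by
  refine ⟨?_, subset_rfl, Set.subset_union_right⟩
  rintro _ ⟨j, rfl⟩
  exact subset_convexHull ℝ _ ⟨j, rfl⟩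

theorem isGreatest_maxMediated : IsGreatest {L | Δ.IsMediated L} Δ.maxMediated := by
  refine ⟨⟨Set.sUnion_subset fun L hL => hL.1, ?_, ?_⟩, fun L hL => Set.subset_sUnion_of_mem hL⟩
  · exact Set.subset_sUnion_of_mem (t := Δ.vertices) Δ.isMediated_vertices
  · refine Set.sUnion_subset fun L hL => hL.2.2.trans ?_
    exact Set.union_subset_union_left _
      (distinctAverages_mono (Set.subset_sUnion_of_mem (t := L) hL))

/-- The class `P_Δ^y` of circuit polynomials `∑ b_j x^{α(j)} + c x^y` with `b_j > 0`, `c ≠ 0` and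
`y` a lattice point in the interior of `Δ` (the class is empty for other `y`). -/
def circuitPolys (y : Fin n →₀ ℕ) : Set (MvPolynomial (Fin n) ℝ) :=
  {f | toReal (toInt y) ∈ interior Δ.carrier ∧
    ∃ (b : Fin (n + 1) → ℝ) (c : ℝ), (∀ j, 0 < b j) ∧ c ≠ 0 ∧
      f = ∑ j, MvPolynomial.monomial (Δ.vertex j) (b j) + MvPolynomial.monomial y c}

end EvenSimplex

/-- `P_{n,2d}`: the nonnegative polynomials in `n` variables of degree at most `2d`. -/
def nonnegPolys (n d : ℕ) : Set (MvPolynomial (Fin n) ℝ) :=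
  {p | p.totalDegree ≤ 2 * d ∧ ∀ x : Fin n → ℝ, 0 ≤ MvPolynomial.eval x p}

/-- `Σ_{n,2d}`: the members of `P_{n,2d}` that are finite sums of squares of polynomials of degree
at most `d`. -/
def sosPolys (n d : ℕ) : Set (MvPolynomial (Fin n) ℝ) :=
  {p | p ∈ nonnegPolys n d ∧ ∃ (k : ℕ) (q : Fin k → MvPolynomial (Fin n) ℝ),
    (∀ i, (q i).totalDegree ≤ d) ∧ p = ∑ i, q i ^ 2}

namespace EvenSimplex

/-- On `Δ`, nonnegative circuit polynomials and sums of squares coincide: for all `y` and `d` the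
sections `P_{n,2d} ∩ P_Δ^y` and `Σ_{n,2d} ∩ P_Δ^y` are equal. -/
def NonnegEqSOS {n : ℕ} (Δ : EvenSimplex n) : Prop :=
  ∀ (y : Fin n →₀ ℕ) (d : ℕ), nonnegPolys n d ∩ Δ.circuitPolys y = sosPolys n d ∩ Δ.circuitPolys y

/-- The even simplices (with ordered vertices) whose vertices are exponents of monomials of degree
at most `2d`. -/
def ofDegree (n d : ℕ) : Set (EvenSimplex n) :=
  {Δ | ∀ j, ∑ i, Δ.vertex j i ≤ 2 * d}

end EvenSimplex

/-- Almost all even simplices in `ℝⁿ` have the property `Q`: the proportion of those with `Q`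
among all even simplices of degree at most `2d` tends to `1` as `d → ∞`. (Vertices are ordered;
for properties that do not depend on the order this is the proportion of unordered simplices.) -/
def AlmostAllEvenSimplices (n : ℕ) (Q : EvenSimplex n → Prop) : Prop :=
  Filter.Tendsto
    (fun d : ℕ => ((EvenSimplex.ofDegree n d ∩ {Δ | Q Δ}).ncard : ℝ) /
      ((EvenSimplex.ofDegree n d).ncard : ℝ))
    Filter.atTop (nhds 1)

/-! Write T = ½Δ, a lattice triangle. Lattice triangles are normal (`exists_add_eq`), so each
lattice point of Δ = 2T is s + t with s, t lattice points of T, that is, the average of the even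
points 2s and 2t. If s ≠ t this is already a mediation. Hence Δ is an H-simplex as soon as every
lattice point v of T other than a vertex is the midpoint of two distinct lattice points of T
(`isHSimplex_of_isMidpointIn`).

Suppose such a v is not a midpoint. Seen from v, the lattice points of T form a convex configuration
without opposite nonzero vectors. This rigidity forces a basis s, t of ℤ² such that every other
lattice point of T lies on one of the rays from v along s, t, -s - t (`exists_rays`). Since v is
interior, each ray carries at most one boundary point, so ∂T has at most three lattice points. The
vertices sit at multiples k, l, m on the three rays, and twice the area of T is kl + lm + mk. Two of
the multiples must be 1, so for T in [0, d]² this is at most 2d + 1. Thus an exceptional T is thin.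

Among about d⁶ triangles, only O(d^(11/2)) have twice the area at most 2d + 1: with five coordinates
fixed, the sixth is usually confined to a short interval. This gives the density statements.

For sums of squares, attach to each point γ of Δ* the agiform ∑ λ_j x^α(j) - x^γ, where λ is the
barycentric coordinate vector of γ. It vanishes at vertices, and at a midpoint of two even points it
exceeds the mean of its two neighbours by half a binomial square. A discrete minimum principle with
values in the cone of sums of squares (`mem_cone_of_superharmonic`) makes all agiforms sums of
squares. After rescaling the variables, a nonnegative circuit polynomial is a nonnegative
combination of an agiform and monomial squares. -/

/-! ### Oriented areas and lattice triangles -/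

/-- Twice the signed area of the lattice triangle `a b c`. -/
def orient (a b c : Fin 2 → ℤ) : ℤ :=
  (b 0 - a 0) * (c 1 - a 1) - (b 1 - a 1) * (c 0 - a 0)

/-- The determinant of two lattice vectors. -/
def ldet (x y : Fin 2 → ℤ) : ℤ := x 0 * y 1 - x 1 * y 0

/-- `p` lies in the positively oriented lattice triangle `a b c`. -/
def InTri (a b c p : Fin 2 → ℤ) : Prop :=
  0 ≤ orient a b p ∧ 0 ≤ orient b c p ∧ 0 ≤ orient c a p

theorem orient_rotate (a b c : Fin 2 → ℤ) : orient b c a = orient a b c := by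
  simp only [orient]; ring

theorem orient_swap (a b c : Fin 2 → ℤ) : orient a c b = - orient a b c := by
  simp only [orient]; ring

theorem orient_sum (a b c p : Fin 2 → ℤ) :
    orient a b p + orient b c p + orient c a p = orient a b c := by
  simp only [orient]; ring

theorem InTri.rotate {a b c p : Fin 2 → ℤ} (h : InTri a b c p) : InTri b c a p :=
  ⟨h.2.1, h.2.2, h.1⟩

theorem orient_comb {p q r x : Fin 2 → ℤ} {i j k : ℤ}
    (hx : (i + j + k) • x = i • p + j • q + k • r) (a b : Fin 2 → ℤ) :
    (i + j + k) * orient a b x = i * orient a b p + j * orient a b q + k * orient a b r := by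
  have h0 := congrFun hx 0
  have h1 := congrFun hx 1
  simp only [Pi.smul_apply, Pi.add_apply, smul_eq_mul] at h0 h1
  simp only [orient]
  linear_combination (b 0 - a 0) * h1 - (b 1 - a 1) * h0

/-- Lattice triangles are convex. -/
theorem InTri.comb {a b c p q r x : Fin 2 → ℤ} {i j k : ℤ} (hi : 0 ≤ i) (hj : 0 ≤ j) (hk : 0 ≤ k)
    (hn : 0 < i + j + k) (hx : (i + j + k) • x = i • p + j • q + k • r)
    (hp : InTri a b c p) (hq : InTri a b c q) (hr : InTri a b c r) : InTri a b c x := by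
  have key : ∀ a b : Fin 2 → ℤ, 0 ≤ orient a b p → 0 ≤ orient a b q → 0 ≤ orient a b r →
      0 ≤ orient a b x := by
    intro a b h1 h2 h3
    have h := orient_comb hx a b
    have : 0 ≤ (i + j + k) * orient a b x := by rw [h]; positivity
    exact nonneg_of_mul_nonneg_right this hn
  exact ⟨key _ _ hp.1 hq.1 hr.1, key _ _ hp.2.1 hq.2.1 hr.2.1, key _ _ hp.2.2 hq.2.2 hr.2.2⟩

theorem inTri_vertex {a b c : Fin 2 → ℤ} (h : 0 ≤ orient a b c) :
    InTri a b c a ∧ InTri a b c b ∧ InTri a b c c := by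
  have e1 : ∀ x y : Fin 2 → ℤ, orient x y x = 0 := fun x y => by simp [orient]
  have e2 : ∀ x y : Fin 2 → ℤ, orient x y y = 0 := fun x y => by simp only [orient]; ring
  have h2 := (orient_rotate a b c)
  have h3 := (orient_rotate b c a)
  refine ⟨⟨?_, ?_, ?_⟩, ⟨?_, ?_, ?_⟩, ⟨?_, ?_, ?_⟩⟩ <;>
    first | exact (e1 _ _).ge | exact (e2 _ _).ge | omega

theorem bary_eq (a b c p : Fin 2 → ℤ) :
    orient a b c • p = orient b c p • a + orient c a p • b + orient a b p • c := by
  ext i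
  fin_cases i <;> simp [orient] <;> ring

/-! ### Lattice triangles are normal -/

/-- Twice the signed area coordinate of `w` with respect to the doubled edge `2a, 2b`. -/
def orient₂ (a b w : Fin 2 → ℤ) : ℤ :=
  (b 0 - a 0) * (w 1 - 2 * a 1) - (b 1 - a 1) * (w 0 - 2 * a 0)

/-- The barycentric coordinates of w with respect to T, normalised to sum 2, are nonnegative and the
one at c is at least 1, so the summand c can be split off. -/
theorem exists_add_of_le {a b c w : Fin 2 → ℤ} (hN : 0 < orient a b c)
    (h1 : orient a b c ≤ orient₂ a b w) (h2 : 0 ≤ orient₂ b c w) (h3 : 0 ≤ orient₂ c a w) :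
    ∃ s t, InTri a b c s ∧ InTri a b c t ∧ s + t = w := by
  refine ⟨w - c, c, ⟨?_, ?_, ?_⟩, (inTri_vertex hN.le).2.2, by simp⟩
  · have : orient a b (w - c) = orient₂ a b w - orient a b c := by
      simp [orient, orient₂]; ring
    omega
  · have : orient b c (w - c) = orient₂ b c w := by
      simp [orient, orient₂]; ring
    omega
  · have : orient c a (w - c) = orient₂ c a w := by
      simp [orient, orient₂]; ring
    omega

theorem InTri.trans {a b c u x y z : Fin 2 → ℤ} (hN : 0 < orient x y z)
    (hx : InTri a b c x) (hy : InTri a b c y) (hz : InTri a b c z)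
    (hu : InTri x y z u) : InTri a b c u := by
  have hs := orient_sum x y z u
  refine InTri.comb hu.2.1 hu.2.2 hu.1 (by omega) ?_ hx hy hz
  rw [← bary_eq]
  congr 1
  omega

/-- Normality of lattice triangles, by induction on the area: either a vertex splits off, or T is
subdivided at an interior lattice point u and w lies in the double of one of the three smaller
triangles. -/
theorem exists_add_eq {a b c w : Fin 2 → ℤ} (hN : 0 < orient a b c)
    (h1 : 0 ≤ orient₂ a b w) (h2 : 0 ≤ orient₂ b c w) (h3 : 0 ≤ orient₂ c a w) :
    ∃ s t, InTri a b c s ∧ InTri a b c t ∧ s + t = w := by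
  induction hm : (orient a b c).toNat using Nat.strong_induction_on generalizing a b c with
  | _ m ih =>
  subst hm
  by_cases l1 : orient a b c ≤ orient₂ a b w
  · exact exists_add_of_le hN l1 h2 h3
  have r1 := orient_rotate a b c
  have r2 := orient_rotate b c a
  by_cases l2 : orient a b c ≤ orient₂ b c w
  · obtain ⟨s, t, hs, ht, h⟩ := exists_add_of_le (a := b) (b := c) (c := a) (w := w)
      (by omega) (by omega) h3 h1
    exact ⟨s, t, hs.rotate.rotate, ht.rotate.rotate, h⟩
  by_cases l3 : orient a b c ≤ orient₂ c a w
  · obtain ⟨s, t, hs, ht, h⟩ := exists_add_of_le (a := c) (b := a) (c := b) (w := w)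
      (by omega) (by omega) h1 h2
    exact ⟨s, t, hs.rotate, ht.rotate, h⟩
  -- The coordinates of w sum to 2 and are all less than 1, so those of a + b + c - w are positive
  -- and sum to 1: u is interior to T.
  obtain ⟨u, hu⟩ : ∃ u, u = a + b + c - w := ⟨_, rfl⟩
  have u1 : orient a b u = orient a b c - orient₂ a b w := by
    simp [hu, orient, orient₂]; ring
  have u2 : orient b c u = orient a b c - orient₂ b c w := by
    simp [hu, orient, orient₂]; ring
  have u3 : orient c a u = orient a b c - orient₂ c a w := by
    simp [hu, orient, orient₂]; ring
  have us := orient_sum a b c u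
  have huT : InTri a b c u := ⟨by omega, by omega, by omega⟩
  obtain ⟨va, vb, vc⟩ := inTri_vertex hN.le
  have neg : ∀ x y : Fin 2 → ℤ, orient₂ x y w = - orient₂ y x w := fun x y => by
    simp only [orient₂]; ring
  have sub : ∀ x y : Fin 2 → ℤ, InTri a b c x → InTri a b c y → 0 ≤ orient₂ x y w →
      0 < orient x y u → orient x y u < orient a b c →
      0 ≤ orient₂ u x w → orient₂ u y w ≤ 0 →
      ∃ s t, InTri a b c s ∧ InTri a b c t ∧ s + t = w := by
    intro x y hx hy h0 hpos hlt hux huy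
    have := neg y u
    obtain ⟨s, t, hs, ht, h⟩ := ih (orient x y u).toNat (by omega) hpos h0 (by omega) hux rfl
    exact ⟨s, t, InTri.trans hpos hx hy huT hs, InTri.trans hpos hx hy huT ht, h⟩
  -- As u is a positive combination of the vertices, the determinants of w - 2u against the three
  -- spokes cannot all have the same strict sign; this locates w in the double of a subtriangle.
  have rel : orient b c u * orient₂ u a w + orient c a u * orient₂ u b w
      + orient a b u * orient₂ u c w = 0 := by
    have e := bary_eq a b c u
    have e0 := congrFun e 0
    have e1 := congrFun e 1
    simp only [Pi.smul_apply, Pi.add_apply, smul_eq_mul] at e0 e1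
    simp only [orient₂]
    linear_combination (w 0 - 2 * u 0) * e1 - (w 1 - 2 * u 1) * e0
      + ((u 1) * (w 0 - 2 * u 0) - (u 0) * (w 1 - 2 * u 1)) * us
  by_cases ca : 0 ≤ orient₂ u a w
  · by_cases cb : orient₂ u b w ≤ 0
    · exact sub a b va vb h1 (by omega) (by omega) ca cb
    · by_cases cc : orient₂ u c w ≤ 0
      · exact sub b c vb vc h2 (by omega) (by omega) (by omega) cc
      · exfalso
        have p1 : 0 ≤ orient b c u * orient₂ u a w := mul_nonneg (by omega) ca
        have p2 : 0 < orient c a u * orient₂ u b w := mul_pos (by omega) (by omega)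
        have p3 : 0 < orient a b u * orient₂ u c w := mul_pos (by omega) (by omega)
        omega
  · by_cases cc : 0 ≤ orient₂ u c w
    · exact sub c a vc va h3 (by omega) (by omega) cc (by omega)
    · by_cases cb : 0 ≤ orient₂ u b w
      · exact sub b c vb vc h2 (by omega) (by omega) cb (by omega)
      · exfalso
        have p1 : 0 < orient b c u * -orient₂ u a w := mul_pos (by omega) (by omega)
        have p2 : 0 < orient c a u * -orient₂ u b w := mul_pos (by omega) (by omega)
        have p3 : 0 < orient a b u * -orient₂ u c w := mul_pos (by omega) (by omega)
        linarith

/-! ### Lattice-convex sets in which only the origin is the centre of a segment -/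

/-- `P` contains `0`-based lattice convex combinations of any two of its points, and contains no
pair of opposite nonzero points. -/
structure IsPointed (P : (Fin 2 → ℤ) → Prop) : Prop where
  conv : ∀ {x p q : Fin 2 → ℤ} {n i j : ℤ}, 0 < n → 0 ≤ i → 0 ≤ j → i + j ≤ n →
    n • x = i • p + j • q → P p → P q → P x
  pointed : ∀ p, P p → P (-p) → p = 0

theorem ldet_swap (x y : Fin 2 → ℤ) : ldet y x = - ldet x y := by
  simp only [ldet]; ring

theorem ldet_smul_add (x y z p : Fin 2 → ℤ) (n i j : ℤ) (h : n • p = i • x + j • y) :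
    n * ldet z p = i * ldet z x + j * ldet z y := by
  have h0 := congrFun h 0
  have h1 := congrFun h 1
  simp only [Pi.smul_apply, Pi.add_apply, smul_eq_mul] at h0 h1
  simp only [ldet]
  linear_combination z 0 * h1 - z 1 * h0

theorem ldet_self (x : Fin 2 → ℤ) : ldet x x = 0 := by simp only [ldet]; ring

/-- A lattice triangle with a vertex at the origin which is not unimodular contains a lattice point
other than its vertices. -/
theorem exists_mem_triangle {x y : Fin 2 → ℤ} (hD : 2 ≤ ldet x y) :
    ∃ (u : Fin 2 → ℤ) (i j : ℤ), 0 ≤ i ∧ 0 ≤ j ∧ i + j ≤ ldet x y ∧ i < ldet x y ∧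
      j < ldet x y ∧ 0 < i + j ∧ ldet x y • u = i • x + j • y := by
  set D := ldet x y with hDdef
  -- The sublattice spanned by x and y has index D ≥ 2, so one of the standard basis vectors lies
  -- outside it.
  obtain ⟨w, i, j, hw, hij⟩ : ∃ (w : Fin 2 → ℤ) (i j : ℤ), D • w = i • x + j • y ∧
      ¬ (D ∣ i ∧ D ∣ j) := by
    by_contra! hcon
    have c1 := hcon ![1, 0] (y 1) (-x 1) (by
      ext k; fin_cases k <;> simp [hDdef, ldet] <;> ring)
    have c2 := hcon ![0, 1] (-y 0) (x 0) (by
      ext k; fin_cases k <;> simp [hDdef, ldet] <;> ring)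
    obtain ⟨⟨p, hp⟩, ⟨q, hq⟩⟩ := c1
    obtain ⟨⟨r, hr⟩, ⟨s, hs⟩⟩ := c2
    have : D = D * (D * (s * p - r * q)) := by
      conv_lhs => rw [hDdef, ldet]
      linear_combination x 0 * hp + D * p * hs + y 0 * hq - D * q * hr
    have h1 : D * (s * p - r * q) = 1 := by
      have h0 : D ≠ 0 := by omega
      exact mul_left_cancel₀ h0 (by linarith)
    have h2 := Int.eq_one_or_neg_one_of_mul_eq_one h1
    omega
  have i0 := Int.emod_nonneg i (show D ≠ 0 by omega)
  have j0 := Int.emod_nonneg j (show D ≠ 0 by omega)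
  have i1 := Int.emod_lt_of_pos i (show 0 < D by omega)
  have j1 := Int.emod_lt_of_pos j (show 0 < D by omega)
  have ij : 0 < i % D + j % D := by
    by_contra hle
    exact hij ⟨Int.dvd_of_emod_eq_zero (by omega), Int.dvd_of_emod_eq_zero (by omega)⟩
  have hu : D • (w - (i / D) • x - (j / D) • y) = (i % D) • x + (j % D) • y := by
    have e1 := Int.emod_add_mul_ediv i D
    have e2 := Int.emod_add_mul_ediv j D
    ext k
    have := congrFun hw k
    simp only [Pi.smul_apply, Pi.add_apply, Pi.sub_apply, smul_eq_mul] at this ⊢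
    linear_combination this - x k * e1 - y k * e2
  by_cases hle : i % D + j % D ≤ D
  · exact ⟨_, _, _, i0, j0, hle, i1, j1, ij, hu⟩
  -- A point of the parallelogram beyond the diagonal is reflected in the centre of the
  -- parallelogram.
  · refine ⟨x + y - (w - (i / D) • x - (j / D) • y), D - i % D, D - j % D, by omega, by omega,
      by omega, by omega, by omega, by omega, ?_⟩
    rw [smul_sub, hu]
    module

/-- The signs against x put z and u on opposite rays of one line. Dividing by the lattice lengths, P
contains both the primitive vector of that line and its negative. -/
theorem IsPointed.false_of_opposite {P : (Fin 2 → ℤ) → Prop} (hP : IsPointed P)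
    {x z u : Fin 2 → ℤ} (hz : P z) (hu : P u) (h0 : ldet z u = 0) (h1 : ldet x z < 0)
    (h2 : 0 < ldet x u) : False := by
  have hz0 : 0 < Int.gcd (z 0) (z 1) := by
    rw [Int.gcd_pos_iff]
    by_contra! hcon
    simp [ldet, hcon.1, hcon.2] at h1
  obtain ⟨w0, w1, hw, e0, e1⟩ := Int.exists_gcd_one hz0
  set g : ℤ := (Int.gcd (z 0) (z 1) : ℤ) with hg
  have hgpos : 0 < g := Int.natCast_pos.2 hz0
  rw [← Int.isCoprime_iff_gcd_eq_one] at hw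
  obtain ⟨r, s, hrs⟩ := hw
  have hw0 : w0 * u 1 - w1 * u 0 = 0 := by
    have : g * (w0 * u 1 - w1 * u 0) = 0 := by
      rw [← h0, ldet]; rw [e0, e1]; ring
    rcases mul_eq_zero.1 this with h | h
    · omega
    · exact h
  set m := u 0 * r + u 1 * s with hm
  have hu0 : u 0 = m * w0 := by rw [hm]; linear_combination (-u 0) * hrs + s * hw0 * (-1)
  have hu1 : u 1 = m * w1 := by rw [hm]; linear_combination (-u 1) * hrs + r * hw0
  have hxw : x 0 * w1 - x 1 * w0 < 0 := by
    rw [ldet, e0, e1] at h1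
    by_contra! hcon
    nlinarith
  have hmneg : m < 0 := by
    rw [ldet, hu0, hu1] at h2
    by_contra! hcon
    nlinarith
  have hzero : (![w0, w1] : Fin 2 → ℤ) = 0 := by
    refine hP.pointed _ ?_ ?_
    · refine hP.conv (n := g) (i := 1) (j := 0) (p := z) (q := z) hgpos (by omega) (by omega)
        (by omega) ?_ hz hz
      ext k; fin_cases k <;> simp [e0, e1] <;> ring
    · refine hP.conv (n := -m) (i := 1) (j := 0) (p := u) (q := u) (by omega) (by omega) (by omega)
        (by omega) ?_ hu hu
      ext k; fin_cases k <;> simp [hu0, hu1]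
  have z0 := congrFun hzero 0
  have z1 := congrFun hzero 1
  simp at z0 z1
  simp [z0, z1] at hxw

/-- Descent step: a further lattice point u of the triangle 0, x, y replaces y or x according to its
side of the line through z. The origin stays strictly inside and the area drops. On that line u
would be opposite to z, which pointedness forbids. -/
theorem IsPointed.exists_smaller {P : (Fin 2 → ℤ) → Prop} (hP : IsPointed P) {x y z : Fin 2 → ℤ}
    (hx : P x) (hy : P y) (hz : P z) (h1 : 2 ≤ ldet x y) (h2 : 0 < ldet y z) (h3 : 0 < ldet z x) :
    ∃ x' y' z', P x' ∧ P y' ∧ P z' ∧ 0 < ldet x' y' ∧ 0 < ldet y' z' ∧ 0 < ldet z' x' ∧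
      ldet x' y' + ldet y' z' + ldet z' x' < ldet x y + ldet y z + ldet z x := by
  obtain ⟨u, i, j, hi, hj, hij, hi', hj', hpos, hu⟩ := exists_mem_triangle h1
  have hPu : P u := hP.conv (by omega) hi hj hij hu hx hy
  have d1 := ldet_smul_add x y z u _ i j hu
  have d2 := ldet_smul_add x y x u _ i j hu
  have d3 := ldet_smul_add x y y u _ i j hu
  have sw := ldet_swap x y
  have sw2 := ldet_swap y z
  have sw3 := ldet_swap u y
  have sw4 := ldet_swap u z
  have sw5 := ldet_swap z x
  rw [ldet_self] at d2 d3
  have hD0 : ldet x y ≠ 0 := by omega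
  have d2' : ldet x u = j := mul_left_cancel₀ hD0 (by linarith)
  have d3' : ldet u y = i := mul_left_cancel₀ hD0 (by rw [sw3, sw] at d3; linarith)
  rw [sw2] at d1
  rcases lt_trichotomy (ldet z u) 0 with h | h | h
  · have hjpos : 0 < j := by
      by_contra hcon
      have : j = 0 := by omega
      subst this
      nlinarith
    refine ⟨x, u, z, hx, hPu, hz, by omega, by omega, by omega, ?_⟩
    have : ldet u z ≤ ldet y z := by
      by_contra! hcon
      nlinarith
    omega
  · exfalso
    rw [h] at d1
    have hjpos : 0 < j := by
      by_contra hcon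
      have : j = 0 := by omega
      subst this
      nlinarith
    exact hP.false_of_opposite (x := x) hz hPu h (by omega) (by omega)
  · have hipos : 0 < i := by
      by_contra hcon
      have : i = 0 := by omega
      subst this
      nlinarith
    refine ⟨u, y, z, hPu, hy, hz, by omega, by omega, by omega, ?_⟩
    have : ldet z u ≤ ldet z x := by
      by_contra! hcon
      nlinarith
    omega

/-- A unimodular triangle around the origin. -/
theorem IsPointed.exists_unimodular {P : (Fin 2 → ℤ) → Prop} (hP : IsPointed P)
    {x y z : Fin 2 → ℤ} (hx : P x) (hy : P y) (hz : P z) (h1 : 0 < ldet x y) (h2 : 0 < ldet y z)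
    (h3 : 0 < ldet z x) :
    ∃ s t, P s ∧ P t ∧ P (-s - t) ∧ ldet s t = 1 := by
  induction hm : (ldet x y + ldet y z + ldet z x).toNat using Nat.strong_induction_on
    generalizing x y z with
  | _ m ih =>
  subst hm
  by_cases c1 : 2 ≤ ldet x y
  · obtain ⟨x', y', z', p1, p2, p3, q1, q2, q3, hlt⟩ := hP.exists_smaller hx hy hz c1 h2 h3
    exact ih _ (by omega) p1 p2 p3 q1 q2 q3 rfl
  by_cases c2 : 2 ≤ ldet y z
  · obtain ⟨x', y', z', p1, p2, p3, q1, q2, q3, hlt⟩ := hP.exists_smaller hy hz hx c2 h3 h1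
    exact ih _ (by omega) p1 p2 p3 q1 q2 q3 rfl
  by_cases c3 : 2 ≤ ldet z x
  · obtain ⟨x', y', z', p1, p2, p3, q1, q2, q3, hlt⟩ := hP.exists_smaller hz hx hy c3 h1 h2
    exact ih _ (by omega) p1 p2 p3 q1 q2 q3 rfl
  have e1 : ldet x y = 1 := by omega
  have e2 : ldet y z = 1 := by omega
  have e3 : ldet z x = 1 := by omega
  -- When all three determinants are 1, Cramer's relation reads x + y + z = 0.
  refine ⟨x, y, hx, hy, ?_, e1⟩
  convert hz using 1
  simp only [ldet] at e1 e2 e3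
  ext k
  fin_cases k <;> simp
  · linear_combination z 0 * e1 + x 0 * e2 + y 0 * e3
  · linear_combination z 1 * e1 + x 1 * e2 + y 1 * e3

theorem IsPointed.not_add {P : (Fin 2 → ℤ) → Prop} (hP : IsPointed P) {s t : Fin 2 → ℤ}
    (hst : ldet s t = 1) (h : P (-s - t)) : ¬ P (s + t) := by
  intro h'
  have h0 := hP.pointed _ h' (by rwa [neg_add'])
  have : ldet s (s + t) = 1 := by rw [← hst]; simp [ldet]; ring
  rw [h0] at this
  simp [ldet] at this

/-- A point strictly inside the cone, averaged with s or t and the origin, yields s + t, the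
opposite of -s - t. -/
theorem IsPointed.not_cone {P : (Fin 2 → ℤ) → Prop} (hP : IsPointed P) {s t : Fin 2 → ℤ}
    (hst : ldet s t = 1) (hs : P s) (ht : P t) (h : P (-s - t)) {i j : ℤ} (hi : 1 ≤ i)
    (hj : 1 ≤ j) : ¬ P (i • s + j • t) := by
  intro h'
  refine hP.not_add hst h ?_
  rcases le_total i j with hij | hij
  · refine hP.conv (n := j) (i := 1) (j := j - i) (by omega) (by omega) (by omega) (by omega)
      ?_ h' hs
    module
  · refine hP.conv (n := i) (i := 1) (j := i - j) (by omega) (by omega) (by omega) (by omega)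
      ?_ h' ht
    module

/-- Since i + j ≤ ij for i, j ≥ 2, the point s + t lies in the triangle 0, is, jt. -/
theorem IsPointed.not_smul_smul {P : (Fin 2 → ℤ) → Prop} (hP : IsPointed P) {s t : Fin 2 → ℤ}
    (hst : ldet s t = 1) (h : P (-s - t)) {i j : ℤ} (hi : 2 ≤ i) (hj : 2 ≤ j)
    (h1 : P (i • s)) (h2 : P (j • t)) : False := by
  refine hP.not_add hst h ?_
  refine hP.conv (n := i * j) (i := j) (j := i) (by positivity) (by omega) (by omega) (by nlinarith)
      ?_ h1 h2
  module

/-- Every nonzero point lies on one of the three rays spanned by the unimodular triangle. -/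
theorem IsPointed.mem_rays {P : (Fin 2 → ℤ) → Prop} (hP : IsPointed P) {s t : Fin 2 → ℤ}
    (hst : ldet s t = 1) (hs : P s) (ht : P t) (h : P (-s - t)) {p : Fin 2 → ℤ} (hp : P p)
    (h0 : p ≠ 0) : ∃ k : ℤ, 1 ≤ k ∧ ∃ i : Fin 3, p = k • (![s, t, -s - t] i) := by
  obtain ⟨A, hA⟩ : ∃ A, A = ldet p t := ⟨_, rfl⟩
  obtain ⟨B, hB⟩ : ∃ B, B = ldet s p := ⟨_, rfl⟩
  have hp' : p = A • s + B • t := by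
    simp only [ldet] at hA hB hst
    ext k
    fin_cases k <;> simp [hA, hB]
    · linear_combination (-p 0) * hst
    · linear_combination (-p 1) * hst
  have d1 : ldet t (-s - t) = 1 := by rw [← hst]; simp [ldet]; ring
  have d2 : ldet (-s - t) s = 1 := by rw [← hst]; simp [ldet]; ring
  have r1 : -t - (-s - t) = s := by abel
  have r2 : -(-s - t) - s = t := by abel
  -- The signs of A, B and A - B locate p in one of the three cones of the fan spanned by s, t, -s -
  -- t; the open cones are empty by `not_cone`.
  by_cases cA : A < 0
  · rcases lt_trichotomy A B with hAB | hAB | hAB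
    · exfalso
      refine hP.not_cone d1 ht h (by rwa [r1]) (i := B - A) (j := -A) (by omega) (by omega) ?_
      convert hp using 1
      rw [hp']; module
    · refine ⟨-A, by omega, 2, ?_⟩
      rw [hp', ← hAB]
      simp only [Matrix.cons_val]
      module
    · exfalso
      refine hP.not_cone d2 h hs (by rwa [r2]) (i := -B) (j := A - B) (by omega) (by omega) ?_
      convert hp using 1
      rw [hp']; module
  by_cases cB : B < 0
  · exfalso
    refine hP.not_cone d2 h hs (by rwa [r2]) (i := -B) (j := A - B) (by omega) (by omega) ?_
    convert hp using 1
    rw [hp']; module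
  by_cases cA' : A = 0
  · refine ⟨B, ?_, 1, by simp [hp', cA']⟩
    have : B ≠ 0 := by
      rintro rfl
      exact h0 (by simp [hp', cA'])
    omega
  by_cases cB' : B = 0
  · exact ⟨A, by omega, 0, by simp [hp', cB']⟩
  · exact absurd (hp' ▸ hp) (hP.not_cone hst hs ht h (by omega) (by omega))

/-! ### Lattice points that are not midpoints -/

/-- `v` is the midpoint of two distinct lattice points of the lattice triangle `a b c`. -/
def IsMidpointIn (a b c v : Fin 2 → ℤ) : Prop :=
  ∃ s t, InTri a b c s ∧ InTri a b c t ∧ s ≠ t ∧ s + t = 2 • v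

/-- `p` lies in the interior of the lattice triangle `a b c`. -/
def InTriInterior (a b c p : Fin 2 → ℤ) : Prop :=
  0 < orient a b p ∧ 0 < orient b c p ∧ 0 < orient c a p

/-- If the barycentric coordinate of v at c is at least 1/2, the reflection 2v - c of c in v stays
in the triangle. -/
theorem isMidpointIn_of_le {a b c v : Fin 2 → ℤ} (hN : 0 < orient a b c) (hv : InTri a b c v)
    (hc : v ≠ c) (h : orient a b c ≤ 2 * orient a b v) : IsMidpointIn a b c v := by
  refine ⟨2 • v - c, c, ⟨?_, ?_, ?_⟩, (inTri_vertex hN.le).2.2, ?_, by simp⟩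
  · have : orient a b (2 • v - c) = 2 * orient a b v - orient a b c := by
      simp [orient]; ring
    omega
  · have : orient b c (2 • v - c) = 2 * orient b c v := by
      simp [orient]; ring
    have := hv.2.1
    omega
  · have : orient c a (2 • v - c) = 2 * orient c a v := by
      simp [orient]; ring
    have := hv.2.2
    omega
  · intro e
    apply hc
    ext i
    have := congrFun e i
    simp at this
    omega

theorem IsMidpointIn.rotate {a b c v : Fin 2 → ℤ} (h : IsMidpointIn a b c v) :
    IsMidpointIn b c a v := by
  obtain ⟨s, t, hs, ht, h⟩ := h
  exact ⟨s, t, hs.rotate, ht.rotate, h⟩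

/-- All barycentric coordinates are less than 1/2 and sum to 1, so none of them vanishes. -/
theorem inTriInterior_of_not_isMidpointIn {a b c v : Fin 2 → ℤ} (hN : 0 < orient a b c)
    (hv : InTri a b c v) (ha : v ≠ a) (hb : v ≠ b) (hc : v ≠ c) (h : ¬ IsMidpointIn a b c v) :
    InTriInterior a b c v := by
  have r1 := orient_rotate a b c
  have r2 := orient_rotate b c a
  have hs := orient_sum a b c v
  have h1 : ¬ orient a b c ≤ 2 * orient a b v := fun h' => h (isMidpointIn_of_le hN hv hc h')
  have h2 : ¬ orient a b c ≤ 2 * orient b c v := fun h' =>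
    h (isMidpointIn_of_le (a := b) (b := c) (c := a) (by omega) hv.rotate ha
      (by omega)).rotate.rotate
  have h3 : ¬ orient a b c ≤ 2 * orient c a v := fun h' =>
    h (isMidpointIn_of_le (a := c) (b := a) (c := b) (by omega) hv.rotate.rotate hb
      (by omega)).rotate
  exact ⟨by omega, by omega, by omega⟩

theorem isPointed_of_not_isMidpointIn {a b c v : Fin 2 → ℤ} (hv : InTri a b c v)
    (h : ¬ IsMidpointIn a b c v) : IsPointed fun p => InTri a b c (v + p) where
  conv := by
    intro x p q n i j hn hi hj hij hx hp hq
    refine InTri.comb (i := i) (j := j) (k := n - i - j) hi hj (by omega) (by omega) ?_ hp hq hv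
    have e : i + j + (n - i - j) = n := by ring
    rw [e, smul_add, hx]
    module
  pointed := by
    intro p hp hp'
    by_contra h0
    refine h ⟨_, _, hp, hp', ?_, by abel⟩
    intro e
    apply h0
    ext i
    have := congrFun e i
    simp at this ⊢
    omega

/-- A point strictly before another point of the triangle on a ray from an interior point is
interior; hence a ray carries at most one boundary point. -/
theorem inTriInterior_of_ray {a b c v p q r : Fin 2 → ℤ} (hv : InTriInterior a b c v)
    (hq : InTri a b c q) {k l : ℤ} (hk : 1 ≤ k) (hkl : k < l) (hp : p = v + k • r)
    (hq' : q = v + l • r) : InTriInterior a b c p := by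
  have e : (k + (l - k) + 0) • p = k • q + (l - k) • v + (0 : ℤ) • v := by
    rw [hp, hq']; module
  have key : ∀ a b : Fin 2 → ℤ, 0 < orient a b v → 0 ≤ orient a b q → 0 < orient a b p := by
    intro a b h1 h2
    have h := orient_comb e a b
    have h3 : 0 < (l - k) * orient a b v := mul_pos (by omega) h1
    have h4 : 0 ≤ k * orient a b q := mul_nonneg (by omega) h2
    have h5 : 0 < l * orient a b p := by linarith
    exact pos_of_mul_pos_right h5 (by omega)
  exact ⟨key _ _ hv.1 hq.1, key _ _ hv.2.1 hq.2.1, key _ _ hv.2.2 hq.2.2⟩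

/-- Around a nonvertex `v` which is not a midpoint the lattice points of a triangle lie on three
rays spanned by a unimodular triangle. -/
theorem exists_rays {a b c v : Fin 2 → ℤ} (hN : 0 < orient a b c)
    (hv : InTri a b c v) (ha : v ≠ a) (hb : v ≠ b) (hc : v ≠ c) (h : ¬ IsMidpointIn a b c v) :
    InTriInterior a b c v ∧ ∃ s t : Fin 2 → ℤ, ldet s t = 1 ∧
      InTri a b c (v + s) ∧ InTri a b c (v + t) ∧ InTri a b c (v + (-s - t)) ∧
      ∀ p, InTri a b c p → p ≠ v →
        ∃ k : ℤ, 1 ≤ k ∧ ∃ i : Fin 3, p = v + k • (![s, t, -s - t] i) := by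
  have hint := inTriInterior_of_not_isMidpointIn hN hv ha hb hc h
  have hP := isPointed_of_not_isMidpointIn hv h
  refine ⟨hint, ?_⟩
  obtain ⟨va, vb, vc⟩ := inTri_vertex hN.le
  have det : ∀ x y : Fin 2 → ℤ, ldet (x - v) (y - v) = orient x y v := fun x y => by
    simp [ldet, orient]; ring
  obtain ⟨s, t, hs, ht, hst, hd⟩ := hP.exists_unimodular (x := a - v) (y := b - v) (z := c - v)
    (by simpa using va) (by simpa using vb) (by simpa using vc)
    (by rw [det]; exact hint.1) (by rw [det]; exact hint.2.1) (by rw [det]; exact hint.2.2)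
  refine ⟨s, t, hd, hs, ht, hst, fun p hp hpv => ?_⟩
  obtain ⟨k, hk, i, hi⟩ := hP.mem_rays hd hs ht hst (p := p - v) (by simpa using hp)
    (sub_ne_zero.2 hpv)
  exact ⟨k, hk, i, by rw [← hi]; abel⟩

/-- If some nonvertex is not a midpoint, the boundary has only three lattice points. -/
theorem encard_boundary_le {a b c v : Fin 2 → ℤ} (hN : 0 < orient a b c)
    (hv : InTri a b c v) (ha : v ≠ a) (hb : v ≠ b) (hc : v ≠ c) (h : ¬ IsMidpointIn a b c v) :
    {p | InTri a b c p ∧ ¬ InTriInterior a b c p}.encard ≤ 3 := by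
  obtain ⟨hint, s, t, -, -, -, -, hray⟩ := exists_rays hN hv ha hb hc h
  have hne : ∀ p, ¬ InTriInterior a b c p → p ≠ v := by
    rintro p hp rfl; exact hp hint
  choose! k hk i hi using hray
  have hinj : Set.InjOn i {p | InTri a b c p ∧ ¬ InTriInterior a b c p} := by
    rintro p ⟨hp, hp'⟩ q ⟨hq, hq'⟩ e
    have e1 := hi p hp (hne p hp')
    have e2 := hi q hq (hne q hq')
    rw [← e] at e2
    rcases lt_trichotomy (k p) (k q) with hlt | heq | hlt
    · exact absurd (inTriInterior_of_ray hint hq (hk p hp (hne p hp')) hlt e1 e2) hp'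
    · rw [e1, e2, heq]
    · exact absurd (inTriInterior_of_ray hint hp (hk q hq (hne q hq')) hlt e2 e1) hq'
  calc _ ≤ (Set.univ : Set (Fin 3)).encard :=
        Set.encard_le_encard_of_injOn (fun _ _ => Set.mem_univ _) hinj
    _ = 3 := by simp

theorem coord_mem_of_inTri {a b c v : Fin 2 → ℤ} (hN : 0 < orient a b c) (hv : InTri a b c v)
    {d : ℤ} (i : Fin 2) (ha : 0 ≤ a i ∧ a i ≤ d) (hb : 0 ≤ b i ∧ b i ≤ d)
    (hc : 0 ≤ c i ∧ c i ≤ d) : 0 ≤ v i ∧ v i ≤ d := by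
  have e := congrFun (bary_eq a b c v) i
  have hs := orient_sum a b c v
  obtain ⟨h1, h2, h3⟩ := hv
  simp only [Pi.smul_apply, Pi.add_apply, smul_eq_mul] at e
  constructor
  · have : 0 ≤ orient a b c * v i := by
      rw [e]
      exact add_nonneg (add_nonneg (mul_nonneg h2 ha.1) (mul_nonneg h3 hb.1)) (mul_nonneg h1 hc.1)
    exact nonneg_of_mul_nonneg_right this hN
  · have : orient a b c * v i ≤ orient a b c * d := by
      rw [e, ← hs]
      nlinarith [mul_le_mul_of_nonneg_left ha.2 h2, mul_le_mul_of_nonneg_left hb.2 h3,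
        mul_le_mul_of_nonneg_left hc.2 h1]
    exact le_of_mul_le_mul_left this hN

/-- If some nonvertex is not a midpoint, then the triangle is thin. -/
theorem orient_le_of_not_isMidpointIn {a b c v : Fin 2 → ℤ} (hN : 0 < orient a b c)
    (hv : InTri a b c v) (ha : v ≠ a) (hb : v ≠ b) (hc : v ≠ c) (h : ¬ IsMidpointIn a b c v)
    {d : ℤ} (hda : ∀ i, 0 ≤ a i ∧ a i ≤ d) (hdb : ∀ i, 0 ≤ b i ∧ b i ≤ d)
    (hdc : ∀ i, 0 ≤ c i ∧ c i ≤ d) : orient a b c ≤ 2 * d + 1 := by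
  obtain ⟨hint, s, t, hst, hs, ht, hst', hray⟩ := exists_rays hN hv ha hb hc h
  have hP := isPointed_of_not_isMidpointIn hv h
  obtain ⟨va, vb, vc⟩ := inTri_vertex hN.le
  have hdv : ∀ i, 0 ≤ v i ∧ v i ≤ d := fun i => coord_mem_of_inTri hN hv i (hda i) (hdb i) (hdc i)
  set S : Fin 3 → Fin 2 → ℤ := ![s, t, -s - t] with hS
  have d1 : ldet t (-s - t) = 1 := by rw [← hst]; simp [ldet]; ring
  have d2 : ldet (-s - t) s = 1 := by rw [← hst]; simp [ldet]; ring
  have r1 : -t - (-s - t) = s := by abel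
  have r2 : -(-s - t) - s = t := by abel
  have hS1 : ∀ i, ldet (S i) (S (i + 1)) = 1 := by
    intro i; fin_cases i
    · exact hst
    · exact d1
    · exact d2
  have hS0 : ∀ i j, 0 < ldet (S i) (S j) → j = i + 1 := by
    intro i j hij
    have hi := hS1 i
    have hj := hS1 j
    have sw := ldet_swap (S i) (S j)
    have self := ldet_self (S i)
    have : j = i ∨ j = i + 1 ∨ i = j + 1 := by omega
    rcases this with rfl | h | rfl
    · omega
    · exact h
    · omega
  -- Any two of the three rays are cyclically adjacent, so at most one vertex has a multiple
  -- exceeding 1.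
  have hSS : ∀ i (k l : ℤ), InTri a b c (v + k • S i) → InTri a b c (v + l • S (i + 1)) →
      ¬ (2 ≤ k ∧ 2 ≤ l) := by
    rintro i k l h1 h2 ⟨hk, hl⟩
    fin_cases i
    · exact hP.not_smul_smul hst hst' hk hl h1 h2
    · exact hP.not_smul_smul d1 (by rwa [r1]) hk hl h1 h2
    · exact hP.not_smul_smul d2 (by rwa [r2]) hk hl h1 h2
  obtain ⟨k, hk, i, hi⟩ := hray a va ha.symm
  obtain ⟨l, hl, j, hj⟩ := hray b vb hb.symm
  obtain ⟨m, hm, n, hn⟩ := hray c vc hc.symm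
  have det : ∀ (k l : ℤ) (x y : Fin 2 → ℤ), orient (v + k • x) (v + l • y) v = k * l * ldet x y := by
    intro k l x y; simp [ldet, orient]; ring
  have o1 : orient a b v = k * l * ldet (S i) (S j) := by rw [hi, hj, det]
  have o2 : orient b c v = l * m * ldet (S j) (S n) := by rw [hn, hj, det]
  have o3 : orient c a v = m * k * ldet (S n) (S i) := by rw [hi, hn, det]
  have pos : ∀ (k l D : ℤ), 1 ≤ k → 1 ≤ l → 0 < k * l * D → 0 < D := by
    intro k l D hk hl h
    exact pos_of_mul_pos_right h (by positivity)
  have e1 := hS0 i j (pos k l _ hk hl (by rw [← o1]; exact hint.1))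
  have e2 := hS0 j n (pos l m _ hl hm (by rw [← o2]; exact hint.2.1))
  have e3 := hS0 n i (pos m k _ hm hk (by rw [← o3]; exact hint.2.2))
  rw [e1, hS1, mul_one] at o1
  rw [e2, hS1, mul_one] at o2
  rw [e3, hS1, mul_one] at o3
  have n1 := hSS i k l (hi ▸ va) (by rw [← e1]; exact hj ▸ vb)
  have n2 := hSS j l m (hj ▸ vb) (by rw [← e2]; exact hn ▸ vc)
  have n3 := hSS n m k (hn ▸ vc) (by rw [← e3]; exact hi ▸ va)
  -- Some coordinate of the ray direction is a nonzero integer, and v and p both lie in [0, d]².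
  have bound : ∀ (p : Fin 2 → ℤ) (k : ℤ) (i : Fin 3), 1 ≤ k → (∀ i, 0 ≤ p i ∧ p i ≤ d) →
      p = v + k • S i → k ≤ d := by
    intro p k i hk hp e
    by_contra! hkd
    have hz : ∀ x, S i x = 0 := by
      intro x
      have ex := congrFun e x
      simp only [Pi.add_apply, Pi.smul_apply, smul_eq_mul] at ex
      have := hp x
      have := hdv x
      by_contra h0
      rcases lt_or_gt_of_ne h0 with h0 | h0 <;> nlinarith
    have := hS1 i
    simp [ldet, hz] at this
  have b1 := bound a k i hk hda hi
  have b2 := bound b l j hl hdb hj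
  have b3 := bound c m n hm hdc hn
  have hsum := orient_sum a b c v
  rw [o1, o2, o3] at hsum
  -- With two multiples equal to 1, the sum kl + lm + mk is 1 plus twice the third.
  have : (k = 1 ∧ l = 1) ∨ (l = 1 ∧ m = 1) ∨ (m = 1 ∧ k = 1) := by omega
  rcases this with ⟨rfl, rfl⟩ | ⟨rfl, rfl⟩ | ⟨rfl, rfl⟩ <;> linarith

/-! ### Even simplices in barycentric coordinates, and the H-simplex criterion -/

namespace EvenSimplex

variable {n : ℕ} (Δ : EvenSimplex n)

/-- The vertices of an even simplex form an affine basis of `ℝⁿ`. -/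
noncomputable def affineBasis : AffineBasis (Fin (n + 1)) ℝ (Fin n → ℝ) where
  toFun j := toReal (toInt (Δ.vertex j))
  ind' := Δ.affineIndependent
  tot' := by
    rw [Δ.affineIndependent.affineSpan_eq_top_iff_card_eq_finrank_add_one]
    simp

theorem affineBasis_apply (j : Fin (n + 1)) : Δ.affineBasis j = toReal (toInt (Δ.vertex j)) := rfl

theorem mem_carrier_iff (x : Fin n → ℝ) :
    x ∈ Δ.carrier ↔ ∀ j, 0 ≤ Δ.affineBasis.coord j x := by
  have := Δ.affineBasis.convexHull_eq_nonneg_coord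
  exact Set.ext_iff.1 this x

theorem mem_interior_carrier_iff (x : Fin n → ℝ) :
    x ∈ interior Δ.carrier ↔ ∀ j, 0 < Δ.affineBasis.coord j x := by
  have := Δ.affineBasis.interior_convexHull
  exact Set.ext_iff.1 this x

theorem isClosed_carrier : IsClosed Δ.carrier :=
  (Set.finite_range _).isClosed_convexHull ℝ

theorem isBounded_carrier : Bornology.IsBounded Δ.carrier :=
  isBounded_convexHull.2 (Set.finite_range _).isBounded

/-- Half of a vertex. -/
def halfVertex (j : Fin (n + 1)) : Fin n → ℤ := fun i => (Δ.vertex j i : ℤ) / 2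

theorem two_smul_halfVertex (j : Fin (n + 1)) : 2 • Δ.halfVertex j = toInt (Δ.vertex j) := by
  ext i
  obtain ⟨k, hk⟩ := Δ.even j i
  simp only [halfVertex, toInt, Pi.smul_apply, hk, nsmul_eq_mul]
  push_cast
  omega

theorem vertices_eq_range : Δ.vertices = Set.range fun j => 2 • Δ.halfVertex j := by
  simp only [vertices, two_smul_halfVertex]

theorem coord_eq_sum (x : Fin n → ℝ) (i : Fin n) :
    x i = ∑ j, Δ.affineBasis.coord j x * (2 * (Δ.halfVertex j i : ℝ)) := by
  have := congrFun (Δ.affineBasis.linear_combination_coord_eq_self x) i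
  rw [← this]
  simp only [Finset.sum_apply, Pi.smul_apply, smul_eq_mul]
  refine Finset.sum_congr rfl fun j _ => ?_
  have h := congrFun (Δ.two_smul_halfVertex j) i
  simp only [Pi.smul_apply, nsmul_eq_mul] at h
  rw [affineBasis_apply, toReal, ← h]
  push_cast
  rfl

end EvenSimplex

namespace EvenSimplex

variable (Δ : EvenSimplex 2)

/-- Twice the signed area of `½Δ`. -/
def halfOrient : ℤ := orient (Δ.halfVertex 0) (Δ.halfVertex 1) (Δ.halfVertex 2)

/-- Passage from real barycentric coordinates on Δ to integer determinants on ½Δ; the factor 2 comes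
from measuring a point of Δ against edges of half the length. -/
theorem orient₂_eq (p : Fin 2 → ℤ) :
    (orient₂ (Δ.halfVertex 0) (Δ.halfVertex 1) p : ℝ) =
      2 * Δ.affineBasis.coord 2 (toReal p) * Δ.halfOrient ∧
    (orient₂ (Δ.halfVertex 1) (Δ.halfVertex 2) p : ℝ) =
      2 * Δ.affineBasis.coord 0 (toReal p) * Δ.halfOrient ∧
    (orient₂ (Δ.halfVertex 2) (Δ.halfVertex 0) p : ℝ) =
      2 * Δ.affineBasis.coord 1 (toReal p) * Δ.halfOrient := by
  have h0 : (p 0 : ℝ) = _ := Δ.coord_eq_sum (toReal p) 0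
  have h1 : (p 1 : ℝ) = _ := Δ.coord_eq_sum (toReal p) 1
  have hs := Δ.affineBasis.sum_coord_apply_eq_one (toReal p)
  rw [Fin.sum_univ_three] at h0 h1 hs
  generalize Δ.affineBasis.coord 0 (toReal p) = x at *
  generalize Δ.affineBasis.coord 1 (toReal p) = y at *
  generalize Δ.affineBasis.coord 2 (toReal p) = z at *
  have hx : x = 1 - y - z := by linarith
  simp only [halfOrient, orient₂, orient]
  push_cast
  rw [h0, h1, hx]
  refine ⟨?_, ?_, ?_⟩ <;> ring

/-- If the area were zero, the edge functional of the first two half vertices would vanish at every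
lattice point, so those vertices would coincide. -/
theorem halfOrient_ne_zero : Δ.halfOrient ≠ 0 := by
  intro h0
  have key : ∀ p, orient₂ (Δ.halfVertex 0) (Δ.halfVertex 1) p = 0 := by
    intro p
    have := (Δ.orient₂_eq p).1
    rw [h0, Int.cast_zero, mul_zero] at this
    exact_mod_cast this
  have k1 := key (2 • Δ.halfVertex 0 + ![1, 0])
  have k2 := key (2 • Δ.halfVertex 0 + ![0, 1])
  simp [orient₂] at k1 k2
  have : Δ.halfVertex 0 = Δ.halfVertex 1 := by
    ext i; fin_cases i <;> simp <;> omega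
  have e := congrArg (2 • ·) this
  simp only [two_smul_halfVertex] at e
  have := Δ.affineIndependent.injective (a₁ := 0) (a₂ := 1) (by simp only [e])
  exact absurd this (by decide)

/-- Positively oriented description of `Δ`. -/
theorem exists_halfTriangle : ∃ i j : Fin 3,
    ∃ a b c : Fin 2 → ℤ, a = Δ.halfVertex 0 ∧ b = Δ.halfVertex i ∧ c = Δ.halfVertex j ∧
    0 < orient a b c ∧ orient a b c = |Δ.halfOrient| ∧
    (Δ.vertices = {2 • a, 2 • b, 2 • c}) ∧
    (∀ p, toReal p ∈ Δ.carrier ↔ 0 ≤ orient₂ a b p ∧ 0 ≤ orient₂ b c p ∧ 0 ≤ orient₂ c a p) ∧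
    (∀ p, toReal p ∈ interior Δ.carrier ↔
      0 < orient₂ a b p ∧ 0 < orient₂ b c p ∧ 0 < orient₂ c a p) := by
  have neg : ∀ x y w : Fin 2 → ℤ, orient₂ x y w = - orient₂ y x w := fun x y w => by
    simp only [orient₂]; ring
  have cast0 : ∀ z : ℤ, 0 ≤ z ↔ (0 : ℝ) ≤ z := fun z => by simp
  have cast1 : ∀ z : ℤ, 0 < z ↔ (0 : ℝ) < z := fun z => by simp
  rcases lt_or_gt_of_ne Δ.halfOrient_ne_zero with h | h
  · have hR : (0 : ℝ) < - Δ.halfOrient := by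
      have : (Δ.halfOrient : ℝ) < 0 := by exact_mod_cast h
      linarith
    have ho : orient (Δ.halfVertex 0) (Δ.halfVertex 2) (Δ.halfVertex 1) = - Δ.halfOrient :=
      orient_swap _ _ _
    refine ⟨2, 1, _, _, _, rfl, rfl, rfl, by omega, by rw [abs_of_neg h, ho], ?_, ?_, ?_⟩
    · rw [vertices_eq_range]
      ext p
      simp [Fin.exists_fin_succ, eq_comm, or_comm]
    all_goals
      intro p
      obtain ⟨e1, e2, e3⟩ := Δ.orient₂_eq p
      first | rw [mem_interior_carrier_iff] | rw [mem_carrier_iff]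
      rw [neg (Δ.halfVertex 0) (Δ.halfVertex 2), neg (Δ.halfVertex 2) (Δ.halfVertex 1),
        neg (Δ.halfVertex 1) (Δ.halfVertex 0)]
      simp only [cast0, cast1, Fin.forall_fin_succ]
      push_cast
      rw [e1, e2, e3]
    · have : ∀ t : ℝ, 0 ≤ -(2 * t * Δ.halfOrient) ↔ 0 ≤ t := fun t => by
        rw [show -(2 * t * (Δ.halfOrient : ℝ)) = (2 * -Δ.halfOrient) * t by ring]
        exact mul_nonneg_iff_of_pos_left (by linarith)
      simp only [this]
      simp
      tauto
    · have : ∀ t : ℝ, 0 < -(2 * t * Δ.halfOrient) ↔ 0 < t := fun t => by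
        rw [show -(2 * t * (Δ.halfOrient : ℝ)) = (2 * -Δ.halfOrient) * t by ring]
        exact mul_pos_iff_of_pos_left (by linarith)
      simp only [this]
      simp
      tauto
  · have hR : (0 : ℝ) < Δ.halfOrient := by exact_mod_cast h
    refine ⟨1, 2, _, _, _, rfl, rfl, rfl, h, by rw [abs_of_pos h]; rfl, ?_, ?_, ?_⟩
    · rw [vertices_eq_range]
      ext p
      simp [Fin.exists_fin_succ, eq_comm]
    all_goals
      intro p
      obtain ⟨e1, e2, e3⟩ := Δ.orient₂_eq p
      first | rw [mem_interior_carrier_iff] | rw [mem_carrier_iff]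
      simp only [cast0, cast1, Fin.forall_fin_succ]
      rw [e1, e2, e3]
    · have : ∀ t : ℝ, 0 ≤ (2 * t * Δ.halfOrient) ↔ 0 ≤ t := fun t => by
        rw [show (2 * t * (Δ.halfOrient : ℝ)) = (2 * Δ.halfOrient) * t by ring]
        exact mul_nonneg_iff_of_pos_left (by linarith)
      simp only [this]
      simp
      tauto
    · have : ∀ t : ℝ, 0 < (2 * t * Δ.halfOrient) ↔ 0 < t := fun t => by
        rw [show (2 * t * (Δ.halfOrient : ℝ)) = (2 * Δ.halfOrient) * t by ring]
        exact mul_pos_iff_of_pos_left (by linarith)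
      simp only [this]
      simp
      tauto

theorem orient₂_two_smul (a b p : Fin 2 → ℤ) : orient₂ a b (2 • p) = 2 * orient a b p := by
  simp [orient₂, orient]; ring

/-- If every nonvertex of `½Δ` is a midpoint, then `Δ` is an `H`-simplex. -/
theorem isHSimplex_of_isMidpointIn {a b c : Fin 2 → ℤ} (hN : 0 < orient a b c)
    (hV : Δ.vertices = {2 • a, 2 • b, 2 • c})
    (hC : ∀ p, toReal p ∈ Δ.carrier ↔
      0 ≤ orient₂ a b p ∧ 0 ≤ orient₂ b c p ∧ 0 ≤ orient₂ c a p)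
    (hmid : ∀ v, InTri a b c v → v ≠ a → v ≠ b → v ≠ c → IsMidpointIn a b c v) :
    Δ.IsHSimplex := by
  have two : ∀ s, InTri a b c s → 2 • s ∈ latticePoints Δ.carrier := by
    rintro s ⟨h1, h2, h3⟩
    refine (hC _).2 ?_
    simp only [orient₂_two_smul]
    omega
  have even : ∀ s : Fin 2 → ℤ, IsEvenPoint (2 • s) := fun s i => by simp
  have two_inj : ∀ s t : Fin 2 → ℤ, 2 • s = 2 • t → s = t := by
    intro s t h
    ext i
    have := congrFun h i
    simp at this
    omega
  refine Set.Subset.antisymm Δ.isGreatest_maxMediated.1.1 ?_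
  refine Δ.isGreatest_maxMediated.2 ⟨subset_rfl, Δ.isMediated_vertices.1, ?_⟩
  intro β hβ
  by_cases hβV : β ∈ Δ.vertices
  · exact Or.inr hβV
  left
  obtain ⟨h1, h2, h3⟩ := (hC β).1 hβ
  obtain ⟨s, t, hs, ht, hst⟩ := exists_add_eq hN h1 h2 h3
  -- For s ≠ t the even points 2s and 2t mediate β. For s = t, β = 2s and s is not a vertex; a
  -- midpoint representation of s is doubled instead.
  by_cases e : s = t
  · subst e
    rw [hV] at hβV
    simp only [Set.mem_insert_iff, Set.mem_singleton_iff, not_or, ← hst, ← two_smul ℕ s] at hβV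
    obtain ⟨s', t', hs', ht', hne, h⟩ := hmid s hs (fun h => hβV.1 (by rw [h]))
      (fun h => hβV.2.1 (by rw [h])) (fun h => hβV.2.2 (by rw [h]))
    refine ⟨2 • s', two _ hs', 2 • t', two _ ht', fun h => hne (two_inj _ _ h), even _, even _, ?_⟩
    rw [← smul_add, h, ← hst, two_smul ℕ s]
  · refine ⟨2 • s, two _ hs, 2 • t, two _ ht, fun h => e (two_inj _ _ h), even _, even _, ?_⟩
    rw [← smul_add, hst]

theorem isHSimplex_of_boundary (h : 4 ≤ Δ.halfBoundaryPoints.encard) : Δ.IsHSimplex := by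
  obtain ⟨i, j, a, b, c, -, -, -, hN, -, hV, hC, hI⟩ := Δ.exists_halfTriangle
  refine Δ.isHSimplex_of_isMidpointIn hN hV hC fun v hv ha hb hc => ?_
  by_contra hmid
  have hle := encard_boundary_le hN hv ha hb hc hmid
  have hsub : Δ.halfBoundaryPoints ⊆ {p | InTri a b c p ∧ ¬ InTriInterior a b c p} := by
    intro p hp
    have hp' : toReal p ∈ frontier ((1 / 2 : ℝ) • Δ.carrier) := hp
    have h2 : (1 / 2 : ℝ) ≠ 0 := by norm_num
    have e : ((1 / 2 : ℝ))⁻¹ • toReal p = toReal (2 • p) := by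
      ext i; simp [toReal]
    rw [frontier, closure_smul₀' h2, interior_smul₀ h2, Δ.isClosed_carrier.closure_eq,
      Set.mem_sdiff, Set.mem_smul_set_iff_inv_smul_mem₀ h2, Set.mem_smul_set_iff_inv_smul_mem₀ h2,
      e, hC, hI] at hp'
    simp only [orient₂_two_smul] at hp'
    refine ⟨⟨by omega, by omega, by omega⟩, fun h => hp'.2 ?_⟩
    obtain ⟨q1, q2, q3⟩ := h
    omega
  have := (h.trans (Set.encard_le_encard hsub)).trans hle
  exact absurd this (by norm_num)

theorem isHSimplex_of_area {d : ℕ} (hd : Δ ∈ ofDegree 2 d) (h : 2 * (d : ℤ) + 1 < |Δ.halfOrient|) :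
    Δ.IsHSimplex := by
  obtain ⟨i, j, a, b, c, ea, eb, ec, hN, hA, hV, hC, hI⟩ := Δ.exists_halfTriangle
  refine Δ.isHSimplex_of_isMidpointIn hN hV hC fun v hv ha hb hc => ?_
  by_contra hmid
  have hb' : ∀ j i, 0 ≤ Δ.halfVertex j i ∧ Δ.halfVertex j i ≤ d := by
    intro j i
    have := hd j
    rw [Fin.sum_univ_two] at this
    simp only [halfVertex]
    fin_cases i <;> simp <;> omega
  have := orient_le_of_not_isMidpointIn hN hv ha hb hc hmid (d := d) (ea ▸ hb' _) (eb ▸ hb' _)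
    (ec ▸ hb' _)
  omega

end EvenSimplex

/-! ### The cone of sums of squares -/

/-- Sums of squares of polynomials of degree at most `d`. -/
def IsSOSOfDegree {n : ℕ} (d : ℕ) (p : MvPolynomial (Fin n) ℝ) : Prop :=
  ∃ (k : ℕ) (q : Fin k → MvPolynomial (Fin n) ℝ), (∀ i, (q i).totalDegree ≤ d) ∧ p = ∑ i, q i ^ 2

namespace IsSOSOfDegree

variable {n d : ℕ} {p q : MvPolynomial (Fin n) ℝ}

theorem zero : IsSOSOfDegree d (0 : MvPolynomial (Fin n) ℝ) :=
  ⟨0, Fin.elim0, fun i => i.elim0, by simp⟩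

theorem sq (hp : p.totalDegree ≤ d) : IsSOSOfDegree d (p ^ 2) :=
  ⟨1, fun _ => p, fun _ => hp, by simp⟩

theorem add (hp : IsSOSOfDegree d p) (hq : IsSOSOfDegree d q) : IsSOSOfDegree d (p + q) := by
  obtain ⟨k, f, hf, rfl⟩ := hp
  obtain ⟨l, g, hg, rfl⟩ := hq
  refine ⟨k + l, Fin.append f g, fun i => ?_, by simp [Fin.sum_univ_add]⟩
  induction i using Fin.addCases with
  | left i => simpa using hf i
  | right i => simpa using hg i

theorem smul {r : ℝ} (hr : 0 ≤ r) (hp : IsSOSOfDegree d p) : IsSOSOfDegree d (r • p) := by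
  obtain ⟨k, f, hf, rfl⟩ := hp
  refine ⟨k, fun i => Real.sqrt r • f i, fun i => ?_, ?_⟩
  · exact (MvPolynomial.totalDegree_smul_le _ _).trans (hf i)
  · rw [Finset.smul_sum]
    refine Finset.sum_congr rfl fun i _ => ?_
    rw [smul_pow, Real.sq_sqrt hr]

theorem sum {ι : Type*} (s : Finset ι) (f : ι → MvPolynomial (Fin n) ℝ)
    (h : ∀ i ∈ s, IsSOSOfDegree d (f i)) : IsSOSOfDegree d (∑ i ∈ s, f i) :=
  Finset.sum_induction f _ (fun _ _ => add) zero h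

end IsSOSOfDegree

/-! ### Discrete minimum principles -/

theorem sum_ite_smul_subtype {α E : Type*} [DecidableEq α] [AddCommGroup E] [Module ℝ E]
    (p : α → Prop) [Fintype {x // p x}] (H : α → E) (x : α) (hx : ¬ p x → H x = 0) :
    ∑ δ : {x // p x}, (if x = δ.1 then (1 : ℝ) else 0) • H δ.1 = H x := by
  by_cases h : p x
  · rw [Finset.sum_eq_single (⟨x, h⟩ : {x // p x})]
    · simp
    · intro δ _ hδ
      rw [if_neg, zero_smul]
      rintro rfl
      exact hδ rfl
    · simp
  · rw [hx h]
    refine Finset.sum_eq_zero fun δ _ => ?_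
    rw [if_neg, zero_smul]
    rintro rfl
    exact h δ.2

theorem sum_row_smul_subtype {α E : Type*} [DecidableEq α] [AddCommGroup E] [Module ℝ E]
    (p : α → Prop) [Fintype {x // p x}] (H : α → E) (x y z : α) (hx : ¬ p x → H x = 0)
    (hy : ¬ p y → H y = 0) (hz : ¬ p z → H z = 0) :
    ∑ δ : {x // p x}, ((if x = δ.1 then (1 : ℝ) else 0) - (1 / 2) *
      ((if y = δ.1 then 1 else 0) + (if z = δ.1 then 1 else 0))) • H δ.1 =
      H x - (1 / 2 : ℝ) • (H y + H z) := by
  simp only [sub_smul, mul_smul, add_smul, Finset.sum_sub_distrib, ← Finset.smul_sum,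
    Finset.sum_add_distrib]
  rw [sum_ite_smul_subtype p H _ hx, sum_ite_smul_subtype p H _ hy, sum_ite_smul_subtype p H _ hz]

/-- The discrete minimum principle: a function on a finite set of lattice points which vanishes
outside a subset and is superharmonic there is nonnegative. -/
theorem nonneg_of_superharmonic {n : ℕ} (M : Finset (Fin n → ℤ)) (p : (Fin n → ℤ) → Prop)
    (hpM : ∀ x, p x → x ∈ M) (U : (Fin n → ℤ) → ℝ) (hU : ∀ x, ¬ p x → U x = 0)
    (h : ∀ γ, p γ → ∃ s t, s ≠ t ∧ s + t = 2 • γ ∧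
      0 ≤ U γ - (1 / 2) * (U s + U t)) (γ : Fin n → ℤ) : 0 ≤ U γ := by
  classical
  by_contra! hneg
  have hp : ∀ x, U x < 0 → p x := fun x hx => by
    by_contra hpx
    rw [hU x hpx] at hx
    exact lt_irrefl _ hx
  obtain ⟨μ, hμ, hmin⟩ := M.exists_min_image U ⟨γ, hpM _ (hp _ hneg)⟩
  have hμneg : U μ < 0 := (hmin γ (hpM _ (hp _ hneg))).trans_lt hneg
  have hmin' : ∀ x, U μ ≤ U x := fun x => by
    by_cases hx : p x
    · exact hmin x (hpM x hx)
    · rw [hU x hx]; exact hμneg.le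
  -- Among the minimisers one of maximal Euclidean norm is taken. Superharmonicity makes s and t
  -- minimisers too, and strict convexity of the squared norm then forces s = t.
  obtain ⟨ν, hν, hmax⟩ := (M.filter fun x => U x = U μ).exists_max_image
    (fun x => ∑ i, x i ^ 2) ⟨μ, by simp [hμ]⟩
  have hUν : U ν = U μ := (Finset.mem_filter.1 hν).2
  obtain ⟨s, t, hne, hst, hle⟩ := h ν (hp ν (by rw [hUν]; exact hμneg))
  have h1 := hmin' s
  have h2 := hmin' t
  have es : U s = U μ := by linarith
  have et : U t = U μ := by linarith
  have ms := hmax s (Finset.mem_filter.2 ⟨hpM _ (hp _ (by rw [es]; exact hμneg)), es⟩)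
  have mt := hmax t (Finset.mem_filter.2 ⟨hpM _ (hp _ (by rw [et]; exact hμneg)), et⟩)
  have hsum : ∑ i, (s i - t i) ^ 2 = 2 * ∑ i, s i ^ 2 + 2 * ∑ i, t i ^ 2 - 4 * ∑ i, ν i ^ 2 := by
    simp only [Finset.mul_sum, ← Finset.sum_add_distrib, ← Finset.sum_sub_distrib]
    refine Finset.sum_congr rfl fun i _ => ?_
    have := congrFun hst i
    simp only [Pi.add_apply, Pi.smul_apply, nsmul_eq_mul, Nat.cast_ofNat] at this
    linear_combination (-s i - t i - 2 * ν i) * this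
  have hzero : ∑ i, (s i - t i) ^ 2 = 0 :=
    le_antisymm (by linarith) (Finset.sum_nonneg fun i _ => sq_nonneg _)
  rw [Finset.sum_eq_zero_iff_of_nonneg fun i _ => sq_nonneg _] at hzero
  refine hne (funext fun i => ?_)
  have := hzero i (Finset.mem_univ _)
  exact sub_eq_zero.1 (pow_eq_zero_iff two_ne_zero |>.1 this)

/-- A discrete minimum principle with values in a convex cone: a function which vanishes on `V` and
which elsewhere on `M` exceeds the mean of its values at two points with the given midpoint by an
element of the cone takes values in the cone. -/
theorem mem_cone_of_superharmonic {n : ℕ} {E : Type*} [AddCommGroup E] [Module ℝ E] (C : E → Prop)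
    (hC0 : C 0) (hadd : ∀ x y, C x → C y → C (x + y)) (hsmul : ∀ (r : ℝ) x, 0 ≤ r → C x → C (r • x))
    (M : Finset (Fin n → ℤ)) (V : Set (Fin n → ℤ)) (H : (Fin n → ℤ) → E)
    (hV : ∀ γ ∈ V, H γ = 0)
    (hM : ∀ γ ∈ M, γ ∉ V → ∃ s ∈ M, ∃ t ∈ M, s ≠ t ∧ s + t = 2 • γ ∧
      C (H γ - (1 / 2 : ℝ) • (H s + H t))) {β : Fin n → ℤ} (hβ : β ∈ M) : C (H β) := by
  classical
  by_cases hβV : β ∈ V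
  · rwa [hV β hβV]
  let p : (Fin n → ℤ) → Prop := fun γ => γ ∈ M ∧ γ ∉ V
  have : Finite {γ // p γ} := (M.finite_toSet.subset fun γ h => h.1 : Set.Finite {γ | p γ}).to_subtype
  have := Fintype.ofFinite {γ // p γ}
  choose s hs t ht hne hst hCst using fun γ : {γ // p γ} => hM γ.1 γ.2.1 γ.2.2
  -- The identity minus the averaging operator. By the scalar minimum principle it is monotone,
  -- hence invertible with entrywise nonnegative inverse, so H is a nonnegative combination of its
  -- defects.
  let A : Matrix {γ // p γ} {γ // p γ} ℝ := fun γ δ =>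
    (if γ.1 = δ.1 then 1 else 0) - (1 / 2) *
      ((if s γ = δ.1 then 1 else 0) + (if t γ = δ.1 then 1 else 0))
  have hH : ∀ x ∈ M, ¬ p x → H x = 0 := fun x hx hpx => hV x (by
    by_contra hxV; exact hpx ⟨hx, hxV⟩)
  have hAH : ∀ γ, ∑ δ, A γ δ • H δ.1 = H γ.1 - (1 / 2 : ℝ) • (H (s γ) + H (t γ)) := fun γ =>
    sum_row_smul_subtype p H _ _ _ (hH _ γ.2.1) (hH _ (hs γ)) (hH _ (ht γ))
  have hmin : ∀ u : {γ // p γ} → ℝ, 0 ≤ A.mulVec u → 0 ≤ u := by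
    intro u hu γ
    let U : (Fin n → ℤ) → ℝ := fun x => if hx : p x then u ⟨x, hx⟩ else 0
    have hUp : ∀ x, ¬ p x → U x = 0 := fun x hx => dif_neg hx
    have hUu : ∀ δ : {γ // p γ}, U δ.1 = u δ := fun δ => dif_pos δ.2
    rw [Pi.zero_apply, ← hUu]
    refine nonneg_of_superharmonic M p (fun x hx => hx.1) U hUp (fun γ hγ => ?_) _
    refine ⟨s ⟨γ, hγ⟩, t ⟨γ, hγ⟩, hne _, hst _, ?_⟩
    have h1 := sum_row_smul_subtype p U γ (s ⟨γ, hγ⟩) (t ⟨γ, hγ⟩) (hUp _) (hUp _) (hUp _)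
    rw [← smul_eq_mul, ← h1]
    refine (hu ⟨γ, hγ⟩).trans_eq ?_
    simp only [Matrix.mulVec, dotProduct, hUu, smul_eq_mul, A]
  have hinj : Function.Injective A.mulVec := by
    intro u v huv
    have h1 := hmin (u - v) (by rw [Matrix.mulVec_sub, huv, sub_self])
    have h2 := hmin (v - u) (by rw [Matrix.mulVec_sub, huv, sub_self])
    exact le_antisymm (sub_nonneg.1 h2) (sub_nonneg.1 h1)
  have hunit : IsUnit A.det := (Matrix.isUnit_iff_isUnit_det A).1
    (Matrix.mulVec_injective_iff_isUnit.1 hinj)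
  have hpos : ∀ γ δ, 0 ≤ A⁻¹ γ δ := by
    intro γ δ
    refine hmin (fun γ => A⁻¹ γ δ) (fun γ => ?_) γ
    have : A.mulVec (fun γ => A⁻¹ γ δ) γ = (A * A⁻¹) γ δ := rfl
    rw [this, Matrix.mul_nonsing_inv A hunit, Pi.zero_apply, Matrix.one_apply]
    split_ifs <;> norm_num
  have hsum : H β = ∑ γ, A⁻¹ ⟨β, hβ, hβV⟩ γ • (H γ.1 - (1 / 2 : ℝ) • (H (s γ) + H (t γ))) := by
    simp only [← hAH, Finset.smul_sum, smul_smul]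
    rw [Finset.sum_comm]
    simp only [← Finset.sum_smul]
    have : ∀ δ, ∑ γ, A⁻¹ ⟨β, hβ, hβV⟩ γ * A γ δ = (1 : Matrix {γ // p γ} _ ℝ) ⟨β, hβ, hβV⟩ δ := by
      intro δ
      rw [← Matrix.nonsing_inv_mul A hunit]
      rfl
    simp only [this, Matrix.one_apply]
    rw [Finset.sum_eq_single (⟨β, hβ, hβV⟩ : {γ // p γ})]
    · simp
    · intro δ _ hδ
      rw [if_neg hδ.symm, zero_smul]
    · simp
  rw [hsum]
  exact Finset.sum_induction _ C hadd hC0 fun γ _ => hsmul _ _ (hpos _ _) (hCst γ)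

/-! ### Scaled monomials and midpoint binomials -/

section Agiform

variable {n : ℕ}

/-- The exponent vector of a lattice point with nonnegative entries. -/
noncomputable def toExponent (γ : Fin n → ℤ) : Fin n →₀ ℕ :=
  Finsupp.equivFunOnFinite.symm fun i => (γ i).toNat

theorem toExponent_toInt (a : Fin n →₀ ℕ) : toExponent (toInt a) = a := by
  ext i
  simp [toInt, toExponent]

theorem exists_two_mul_of_isEvenPoint {γ : Fin n → ℤ} (h : ∀ i, 0 ≤ γ i) (he : IsEvenPoint γ) :
    ∃ a : Fin n →₀ ℕ, γ = toInt (2 • a) := by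
  refine ⟨Finsupp.equivFunOnFinite.symm fun i => (γ i / 2).toNat, ?_⟩
  ext i
  obtain ⟨k, hk⟩ := he i
  have := h i
  simp only [toInt, Finsupp.smul_apply, Finsupp.equivFunOnFinite_symm_apply_apply, smul_eq_mul]
  push_cast
  omega

theorem totalDegree_monomial_le_of_sum {d : ℕ} {a : Fin n →₀ ℕ} (r : ℝ) (h : ∑ i, a i ≤ d) :
    (MvPolynomial.monomial a r).totalDegree ≤ d := by
  refine (MvPolynomial.totalDegree_monomial_le a r).trans ?_
  rw [Finsupp.sum_fintype _ _ (fun _ => rfl)]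
  exact h

theorem isSOSOfDegree_monomial {d : ℕ} {a : Fin n →₀ ℕ} (ha : ∀ i, Even (a i))
    (hd : ∑ i, a i ≤ 2 * d) {r : ℝ} (hr : 0 ≤ r) :
    IsSOSOfDegree d (MvPolynomial.monomial a r) := by
  choose b hb using ha
  have hab : a = 2 • (Finsupp.equivFunOnFinite.symm b) := by
    ext i
    simp [hb i, two_mul]
  have : MvPolynomial.monomial a r =
      (MvPolynomial.monomial (Finsupp.equivFunOnFinite.symm b) (Real.sqrt r)) ^ 2 := by
    rw [MvPolynomial.monomial_pow, Real.sq_sqrt hr, hab]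
  rw [this]
  refine IsSOSOfDegree.sq (totalDegree_monomial_le_of_sum _ ?_)
  simp only [hb, ← two_mul, ← Finset.mul_sum] at hd
  simpa using hd

/-- The value at `x` of the affine function with linear coefficients `u` and constant term `c`. -/
def affineValue (u : Fin n → ℝ) (c : ℝ) (a : Fin n → ℤ) : ℝ := c + ∑ i, u i * a i

/-- The monomial `x ^ a` scaled by the exponential of an affine function of `a` and by signs. -/
noncomputable def scaledMonomial (u : Fin n → ℝ) (c : ℝ) (ε : Fin n → ℝ) (a : Fin n →₀ ℕ) :
    MvPolynomial (Fin n) ℝ :=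
  MvPolynomial.monomial a (Real.exp (affineValue u c (toInt a)) * ∏ i, ε i ^ a i)

theorem prod_sign_sq {ε : Fin n → ℝ} (hε : ∀ i, ε i ^ 2 = 1) (a : Fin n →₀ ℕ) :
    (∏ i, ε i ^ a i) ^ 2 = 1 := by
  rw [← Finset.prod_pow]
  refine Finset.prod_eq_one fun i _ => ?_
  rw [← pow_mul, mul_comm, pow_mul, hε, one_pow]

theorem prod_sign_even {ε : Fin n → ℝ} (hε : ∀ i, ε i ^ 2 = 1) {a : Fin n →₀ ℕ}
    (ha : ∀ i, Even (a i)) : ∏ i, ε i ^ a i = 1 := by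
  refine Finset.prod_eq_one fun i _ => ?_
  obtain ⟨k, hk⟩ := ha i
  rw [hk, ← two_mul, pow_mul, hε, one_pow]

theorem affineValue_add (u : Fin n → ℝ) (c : ℝ) (a b : Fin n →₀ ℕ) :
    affineValue u c (toInt (a + b)) =
      (affineValue u c (toInt (2 • a)) + affineValue u c (toInt (2 • b))) / 2 := by
  simp only [affineValue, toInt, Finsupp.add_apply, Finsupp.smul_apply, smul_eq_mul]
  push_cast
  simp only [mul_add, Finset.sum_add_distrib, mul_left_comm _ (2 : ℝ), ← Finset.mul_sum]
  ring

/-- The identity ½(X² + Y²) - XY = ½(X - Y)², with X and Y the monomials at a and b. The scaling is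
multiplicative up to a constant, which is split evenly between X and Y. -/
theorem scaledMonomial_midpoint (u : Fin n → ℝ) (c : ℝ) {ε : Fin n → ℝ} (hε : ∀ i, ε i ^ 2 = 1)
    {d : ℕ} (a b : Fin n →₀ ℕ) (ha : ∑ i, a i ≤ d) (hb : ∑ i, b i ≤ d) :
    IsSOSOfDegree d ((1 / 2 : ℝ) • (scaledMonomial u c ε (2 • a) + scaledMonomial u c ε (2 • b))
      - scaledMonomial u c ε (a + b)) := by
  have key : (1 / 2 : ℝ) • (scaledMonomial u c ε (2 • a) + scaledMonomial u c ε (2 • b))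
      - scaledMonomial u c ε (a + b) = (1 / 2 : ℝ) •
      (MvPolynomial.monomial a (Real.exp (affineValue u c (toInt (2 • a)) / 2) * ∏ i, ε i ^ a i)
      - MvPolynomial.monomial b
        (Real.exp (affineValue u c (toInt (2 • b)) / 2) * ∏ i, ε i ^ b i)) ^ 2 := by
    have h2 : ∀ a : Fin n →₀ ℕ, scaledMonomial u c ε (2 • a) = (MvPolynomial.monomial a
        (Real.exp (affineValue u c (toInt (2 • a)) / 2) * ∏ i, ε i ^ a i)) ^ 2 := by
      intro a
      rw [MvPolynomial.monomial_pow, scaledMonomial, mul_pow, prod_sign_sq hε, prod_sign_even hε,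
        ← Real.exp_nat_mul]
      · congr 3
        push_cast; ring
      · intro i; simp
    have h1 : scaledMonomial u c ε (a + b) =
        MvPolynomial.monomial a (Real.exp (affineValue u c (toInt (2 • a)) / 2) * ∏ i, ε i ^ a i) *
        MvPolynomial.monomial b
          (Real.exp (affineValue u c (toInt (2 • b)) / 2) * ∏ i, ε i ^ b i) := by
      rw [MvPolynomial.monomial_mul, scaledMonomial, affineValue_add, add_div, Real.exp_add]
      congr 1
      simp only [Finsupp.add_apply, pow_add, Finset.prod_mul_distrib]
      ring
    rw [h2, h2, h1, sub_sq, smul_add, smul_add, smul_sub, ← smul_mul_assoc, ← smul_mul_assoc,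
      MvPolynomial.smul_eq_C_mul (2 : MvPolynomial (Fin n) ℝ)]
    have : (MvPolynomial.C (1 / 2 : ℝ) * 2 : MvPolynomial (Fin n) ℝ) = 1 := by
      have : (2 : MvPolynomial (Fin n) ℝ) = MvPolynomial.C 2 :=
        (map_ofNat MvPolynomial.C 2).symm
      rw [this, ← MvPolynomial.C_mul]
      norm_num
    rw [this]
    ring
  rw [key]
  refine IsSOSOfDegree.smul (by norm_num) (IsSOSOfDegree.sq ?_)
  exact (MvPolynomial.totalDegree_sub _ _).trans (max_le (totalDegree_monomial_le_of_sum _ ha)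
    (totalDegree_monomial_le_of_sum _ hb))

end Agiform

/-! ### Agiforms and nonnegative circuit polynomials -/

namespace EvenSimplex

variable {n : ℕ} (Δ : EvenSimplex n)

theorem finite_latticePoints : (latticePoints Δ.carrier).Finite := by
  obtain ⟨R, hR⟩ := Δ.isBounded_carrier.subset_closedBall 0
  refine (Set.Finite.pi' (t := fun _ : Fin n => Set.Icc (-⌈R⌉) ⌈R⌉)
    fun _ => Set.finite_Icc _ _).subset fun p hp i => ?_
  have h1 := hR hp
  rw [mem_closedBall_zero_iff] at h1
  have h2 := (norm_le_pi_norm (toReal p) i).trans h1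
  rw [toReal, Real.norm_eq_abs, abs_le] at h2
  have h3 := Int.le_ceil R
  constructor
  · have : ((-⌈R⌉ : ℤ) : ℝ) ≤ p i := by push_cast; linarith
    exact_mod_cast this
  · have : (p i : ℝ) ≤ (⌈R⌉ : ℤ) := by linarith
    exact_mod_cast this

theorem halfVertex_nonneg (j : Fin (n + 1)) (i : Fin n) : 0 ≤ Δ.halfVertex j i := by
  simp only [halfVertex]
  omega

theorem nonneg_of_mem {γ : Fin n → ℤ} (h : γ ∈ latticePoints Δ.carrier) (i : Fin n) : 0 ≤ γ i := by
  have h1 := (Δ.mem_carrier_iff _).1 h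
  have h2 := Δ.coord_eq_sum (toReal γ) i
  have : (0 : ℝ) ≤ (γ i : ℝ) := by
    change 0 ≤ toReal γ i
    rw [h2]
    refine Finset.sum_nonneg fun j _ => mul_nonneg (h1 j) ?_
    have := Δ.halfVertex_nonneg j i
    positivity
  exact_mod_cast this

theorem two_mul_halfVertex (j : Fin (n + 1)) (i : Fin n) :
    (2 * (Δ.halfVertex j i : ℝ)) = Δ.vertex j i := by
  have h := congrFun (Δ.two_smul_halfVertex j) i
  simp only [Pi.smul_apply, nsmul_eq_mul, toInt] at h
  exact_mod_cast h

theorem sum_le_of_mem {d : ℕ} (hd : ∀ j, ∑ i, Δ.vertex j i ≤ 2 * d) {a : Fin n →₀ ℕ}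
    (h : toInt a ∈ latticePoints Δ.carrier) : ∑ i, a i ≤ 2 * d := by
  have h1 := (Δ.mem_carrier_iff _).1 h
  have h2 := Δ.coord_eq_sum (toReal (toInt a))
  have h3 : ∀ i, ((a i : ℕ) : ℝ) = toReal (toInt a) i := fun i => by simp [toReal, toInt]
  have : ((∑ i, a i : ℕ) : ℝ) ≤ ((2 * d : ℕ) : ℝ) := by
    push_cast
    simp only [h3, h2, two_mul_halfVertex]
    rw [Finset.sum_comm]
    simp only [← Finset.mul_sum]
    calc _ ≤ ∑ j, Δ.affineBasis.coord j (toReal (toInt a)) * (2 * d : ℝ) := by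
          refine Finset.sum_le_sum fun j _ => mul_le_mul_of_nonneg_left ?_ (h1 j)
          exact_mod_cast hd j
      _ = 2 * d := by rw [← Finset.sum_mul, AffineBasis.sum_coord_apply_eq_one, one_mul]
  exact_mod_cast this

theorem coord_midpoint (j : Fin (n + 1)) {γ s t : Fin n → ℤ} (h : s + t = 2 • γ) :
    Δ.affineBasis.coord j (toReal γ) = (1 / 2) * (Δ.affineBasis.coord j (toReal s) +
      Δ.affineBasis.coord j (toReal t)) := by
  have e : toReal γ = midpoint ℝ (toReal s) (toReal t) := by
    rw [midpoint_eq_smul_add]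
    ext i
    have := congrFun h i
    simp only [Pi.add_apply, Pi.smul_apply, nsmul_eq_mul] at this
    have : (s i : ℝ) + t i = 2 * γ i := by exact_mod_cast this
    simp only [toReal, Pi.smul_apply, Pi.add_apply, this]
    simp
  rw [e, AffineMap.map_midpoint, midpoint_eq_smul_add]
  simp

theorem coord_vertex (j k : Fin (n + 1)) :
    Δ.affineBasis.coord j (toReal (toInt (Δ.vertex k))) = if j = k then 1 else 0 :=
  Δ.affineBasis.coord_apply j k

/-- Agiforms of points in the maximal mediated set are sums of squares. -/
theorem isSOSOfDegree_agiform {d : ℕ} (hd : ∀ j, ∑ i, Δ.vertex j i ≤ 2 * d) (u : Fin n → ℝ) (c : ℝ)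
    {ε : Fin n → ℝ} (hε : ∀ i, ε i ^ 2 = 1) {y : Fin n →₀ ℕ} (hy : toInt y ∈ Δ.maxMediated) :
    IsSOSOfDegree d (∑ j, Δ.affineBasis.coord j (toReal (toInt y)) •
      scaledMonomial u c ε (Δ.vertex j) - scaledMonomial u c ε y) := by
  obtain ⟨⟨hsub, -, hmed⟩, -⟩ := Δ.isGreatest_maxMediated
  have hfin : Δ.maxMediated.Finite := Δ.finite_latticePoints.subset hsub
  -- Barycentric coordinates are affine, so in the defect at a midpoint the vertex terms cancel and
  -- only the binomial of `scaledMonomial_midpoint` remains.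
  have key := mem_cone_of_superharmonic (IsSOSOfDegree d) IsSOSOfDegree.zero
    (fun _ _ => IsSOSOfDegree.add) (fun _ _ => IsSOSOfDegree.smul) hfin.toFinset Δ.vertices
    (fun γ => ∑ j, Δ.affineBasis.coord j (toReal γ) • scaledMonomial u c ε (Δ.vertex j)
      - scaledMonomial u c ε (toExponent γ)) ?_ ?_ (β := toInt y) (by simpa using hy)
  · simpa only [toExponent_toInt] using key
  · rintro _ ⟨k, rfl⟩
    simp [toExponent_toInt, coord_vertex]
  · intro γ hγ hγV
    rcases hmed (hfin.mem_toFinset.1 hγ) with h | h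
    · obtain ⟨s, hs, t, ht, hne, es, et, hst⟩ := h
      refine ⟨s, by simpa using hs, t, by simpa using ht, hne, hst.symm, ?_⟩
      obtain ⟨a, rfl⟩ := exists_two_mul_of_isEvenPoint (Δ.nonneg_of_mem (hsub hs)) es
      obtain ⟨b, rfl⟩ := exists_two_mul_of_isEvenPoint (Δ.nonneg_of_mem (hsub ht)) et
      have hγ' : γ = toInt (a + b) := by
        ext i
        have := congrFun hst i
        simp [toInt] at this ⊢
        omega
      have half : ∀ a : Fin n →₀ ℕ, toInt (2 • a) ∈ Δ.maxMediated → ∑ i, a i ≤ d := by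
        intro a ha
        have := Δ.sum_le_of_mem hd (hsub ha)
        simp only [Finsupp.smul_apply, smul_eq_mul, ← Finset.mul_sum] at this
        omega
      convert scaledMonomial_midpoint u c hε a b (half a hs) (half b ht) using 1
      simp only [Δ.coord_midpoint _ hst.symm]
      rw [hγ']
      simp only [toExponent_toInt, mul_smul, add_smul, ← Finset.smul_sum, Finset.sum_add_distrib]
      module
    · exact absurd h hγV

/-- An affine function with prescribed values at the vertices. -/
theorem exists_affineValue (r : Fin (n + 1) → ℝ) :
    ∃ u c, ∀ j, affineValue u c (toInt (Δ.vertex j)) = r j := by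
  let g : (Fin n → ℝ) →ᵃ[ℝ] ℝ := ∑ j, r j • Δ.affineBasis.coord j
  have hg : ∀ j, g (toReal (toInt (Δ.vertex j))) = r j := by
    intro j
    have : g (toReal (toInt (Δ.vertex j))) =
        ∑ k, r k * Δ.affineBasis.coord k (toReal (toInt (Δ.vertex j))) := by
      have h : ∀ (s : Finset (Fin (n + 1))) (x : Fin n → ℝ), (∑ j ∈ s, r j • Δ.affineBasis.coord j) x
          = ∑ k ∈ s, r k * Δ.affineBasis.coord k x := by
        intro s x
        induction s using Finset.induction_on with
        | empty => simp
        | insert a s ha ih => rw [Finset.sum_insert ha, Finset.sum_insert ha, ← ih]; simp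
      exact h _ _
    rw [this]
    simp [coord_vertex]
  refine ⟨fun i => g.linear fun k => if i = k then 1 else 0, g 0, fun j => ?_⟩
  rw [← hg j, affineValue]
  have h1 := congrFun g.decomp (toReal (toInt (Δ.vertex j)))
  rw [h1]
  simp only [Pi.add_apply]
  rw [add_comm, LinearMap.pi_apply_eq_sum_univ g.linear]
  simp [toReal, mul_comm]

theorem affineIndependent_injective : Function.Injective Δ.vertex := by
  intro j k h
  exact Δ.affineIndependent.injective (by simp only [h])

/-- In positive dimension the interior point y is not a vertex, so no vertex monomial cancels and
the degree of f bounds the degrees of the vertices. -/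
theorem sum_vertex_le {d : ℕ} {f : MvPolynomial (Fin n) ℝ} {y : Fin n →₀ ℕ}
    {b : Fin (n + 1) → ℝ} {c : ℝ} (hy : toReal (toInt y) ∈ interior Δ.carrier) (hb : ∀ j, 0 < b j)
    (hf : f = ∑ j, MvPolynomial.monomial (Δ.vertex j) (b j) + MvPolynomial.monomial y c)
    (hd : f.totalDegree ≤ 2 * d) (j : Fin (n + 1)) : ∑ i, Δ.vertex j i ≤ 2 * d := by
  rcases Nat.eq_zero_or_pos n with rfl | hn
  · simp
  have hne : y ≠ Δ.vertex j := by
    rintro rfl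
    obtain ⟨k, hk⟩ : ∃ k, k ≠ j := by
      have : Nontrivial (Fin (n + 1)) := Fin.nontrivial_iff_two_le.2 (by omega)
      exact exists_ne j
    have := (Δ.mem_interior_carrier_iff _).1 hy k
    rw [coord_vertex, if_neg hk] at this
    exact lt_irrefl _ this
  have hcoeff : MvPolynomial.coeff (Δ.vertex j) f = b j := by
    classical
    rw [hf, MvPolynomial.coeff_add, MvPolynomial.coeff_sum, MvPolynomial.coeff_monomial, if_neg hne,
      add_zero, Finset.sum_eq_single j]
    · simp
    · intro k _ hk
      rw [MvPolynomial.coeff_monomial, if_neg fun h => hk (Δ.affineIndependent_injective h)]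
    · simp
  have := MvPolynomial.le_totalDegree (p := f) (s := Δ.vertex j)
    (MvPolynomial.mem_support_iff.2 (by rw [hcoeff]; exact (hb j).ne'))
  rw [Finsupp.sum_fintype _ _ (fun _ => rfl)] at this
  exact this.trans hd

/-- The evaluation point undoes the exponential scaling: at it all scaled monomials have the same
absolute value, the exponential of c. -/
theorem eval_monomial_scaled {u ε : Fin n → ℝ} (c r : ℝ) (a : Fin n →₀ ℕ) :
    MvPolynomial.eval (fun i => ε i * Real.exp (-u i)) (MvPolynomial.monomial a r) =
      r * (∏ i, ε i ^ a i) * Real.exp (c - affineValue u c (toInt a)) := by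
  have h : Real.exp (c - affineValue u c (toInt a)) = ∏ i, Real.exp (-u i) ^ a i := by
    simp only [← Real.exp_nat_mul, ← Real.exp_sum, affineValue, toInt]
    congr 1
    rw [sub_add_cancel_left, ← Finset.sum_neg_distrib]
    refine Finset.sum_congr rfl fun i _ => ?_
    push_cast; ring
  rw [h, MvPolynomial.eval_monomial, Finsupp.prod_fintype _ _ (fun _ => pow_zero _), mul_assoc,
    ← Finset.prod_mul_distrib]
  simp only [mul_pow]

/-- A nonnegative circuit polynomial whose inner exponent lies in the maximal mediated set is a sum
of squares. -/
theorem isSOSOfDegree_of_nonneg {d : ℕ} {f : MvPolynomial (Fin n) ℝ} {y : Fin n →₀ ℕ}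
    (hyM : toInt y ∈ Δ.maxMediated) (hdeg : f.totalDegree ≤ 2 * d)
    (hnn : ∀ x, 0 ≤ MvPolynomial.eval x f) (hf : f ∈ Δ.circuitPolys y) :
    IsSOSOfDegree d f := by
  obtain ⟨hy, b, c, hb, hc, hfe⟩ := hf
  have hd := Δ.sum_vertex_le hy hb hfe hdeg
  have hpos := (Δ.mem_interior_carrier_iff _).1 hy
  by_cases hcase : 0 ≤ c ∧ ∀ i, Even (y i)
  · rw [hfe]
    exact (IsSOSOfDegree.sum _ _ fun j _ => isSOSOfDegree_monomial (Δ.even j) (hd j) (hb j).le).add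
      (isSOSOfDegree_monomial hcase.2
        (Δ.sum_le_of_mem hd (Δ.isGreatest_maxMediated.1.1 hyM)) hcase.1)
  -- Outside the monomial-square case, either c < 0 or some exponent of y is odd; a sign change of
  -- that variable makes the inner term as negative as possible.
  obtain ⟨ε, hε, hεc⟩ : ∃ ε : Fin n → ℝ, (∀ i, ε i ^ 2 = 1) ∧ c * ∏ i, ε i ^ y i = -|c| := by
    by_cases h0 : 0 ≤ c
    · have : ∃ i, ¬ Even (y i) := by
        by_contra! hall
        exact hcase ⟨h0, hall⟩
      obtain ⟨i, hi⟩ := this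
      refine ⟨fun k => if k = i then -1 else 1, fun k => ?_, ?_⟩
      · simp only
        split_ifs <;> norm_num
      · rw [Finset.prod_eq_single i]
        · beta_reduce
          rw [if_pos rfl, (Nat.not_even_iff_odd.1 hi).neg_one_pow, abs_of_nonneg h0]; ring
        · intro k _ hk
          beta_reduce
          rw [if_neg hk, one_pow]
        · simp
    · refine ⟨fun _ => 1, fun _ => one_pow _, ?_⟩
      rw [abs_of_neg (not_le.1 h0)]
      simp
  -- An affine function ℓ with b j = λ_j exp ℓ(α(j)). Then κ = exp ℓ(y) is the circuit number, and
  -- nonnegativity at a single point gives |c| ≤ κ.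
  obtain ⟨u, c₀, hu⟩ := Δ.exists_affineValue
    fun j => Real.log (b j / Δ.affineBasis.coord j (toReal (toInt y)))
  have hbj : ∀ j, b j = Δ.affineBasis.coord j (toReal (toInt y)) *
      Real.exp (affineValue u c₀ (toInt (Δ.vertex j))) := by
    intro j
    rw [hu, Real.exp_log (div_pos (hb j) (hpos j)), mul_div_cancel₀ _ (hpos j).ne']
  have hsum := Δ.affineBasis.sum_coord_apply_eq_one (toReal (toInt y))
  set κ := Real.exp (affineValue u c₀ (toInt y)) with hκ
  have hκpos : 0 < κ := Real.exp_pos _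
  have hle : |c| ≤ κ := by
    have h := hnn fun i => ε i * Real.exp (-u i)
    rw [hfe, map_add, map_sum] at h
    simp only [eval_monomial_scaled c₀, prod_sign_even hε (Δ.even _), hbj, Real.exp_sub, hεc,
      ← hκ] at h
    have h2 : ∀ j, Δ.affineBasis.coord j (toReal (toInt y)) *
        Real.exp (affineValue u c₀ (toInt (Δ.vertex j))) * 1 *
        (Real.exp c₀ / Real.exp (affineValue u c₀ (toInt (Δ.vertex j)))) =
        Δ.affineBasis.coord j (toReal (toInt y)) * Real.exp c₀ := by
      intro j
      have := (Real.exp_pos (affineValue u c₀ (toInt (Δ.vertex j)))).ne'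
      field_simp
    simp only [h2, ← Finset.sum_mul, hsum] at h
    have h3 : 0 ≤ Real.exp c₀ * (1 - |c| / κ) := by
      refine h.trans_eq ?_
      ring
    have h4 := nonneg_of_mul_nonneg_right h3 (Real.exp_pos _)
    rw [sub_nonneg, div_le_one hκpos] at h4
    exact h4
  have hagi := Δ.isSOSOfDegree_agiform hd u c₀ hε hyM
  have hθ0 : 0 ≤ |c| / κ := by positivity
  have hθ1 : 0 ≤ 1 - |c| / κ := by
    rw [sub_nonneg, div_le_one hκpos]; exact hle
  have hvert : ∀ j, Δ.affineBasis.coord j (toReal (toInt y)) • scaledMonomial u c₀ ε (Δ.vertex j)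
      = MvPolynomial.monomial (Δ.vertex j) (b j) := by
    intro j
    rw [scaledMonomial, MvPolynomial.smul_monomial, prod_sign_even hε (Δ.even j), mul_one, hbj j,
      smul_eq_mul]
  have hmono : MvPolynomial.monomial y c = -((|c| / κ) • scaledMonomial u c₀ ε y) := by
    rw [scaledMonomial, MvPolynomial.smul_monomial, ← map_neg, ← hκ, smul_eq_mul]
    congr 1
    have h1 := prod_sign_sq hε y
    have h2 : |c| / κ * (κ * ∏ i, ε i ^ y i) = |c| * ∏ i, ε i ^ y i := by
      field_simp
    rw [h2]
    linear_combination (-c) * h1 + (∏ i, ε i ^ y i) * hεc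
  -- f interpolates between the extremal case |c| = κ, which is the agiform, and the sum of the
  -- vertex monomials.
  have hdec : f = (|c| / κ) • (∑ j, Δ.affineBasis.coord j (toReal (toInt y)) •
      scaledMonomial u c₀ ε (Δ.vertex j) - scaledMonomial u c₀ ε y) +
      (1 - |c| / κ) • ∑ j, MvPolynomial.monomial (Δ.vertex j) (b j) := by
    simp only [hvert]
    rw [hfe, hmono]
    module
  rw [hdec]
  exact (hagi.smul hθ0).add (IsSOSOfDegree.smul hθ1 (IsSOSOfDegree.sum _ _ fun j _ =>
    isSOSOfDegree_monomial (Δ.even j) (hd j) (hb j).le))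

theorem IsHSimplex.nonnegEqSOS {Δ : EvenSimplex n} (h : Δ.IsHSimplex) : Δ.NonnegEqSOS := by
  intro y d
  ext f
  constructor
  · rintro ⟨hf, hc⟩
    refine ⟨⟨hf, ?_⟩, hc⟩
    refine Δ.isSOSOfDegree_of_nonneg ?_ hf.1 hf.2 hc
    rw [h]
    exact (interior_subset hc.1 : toReal (toInt y) ∈ Δ.carrier)
  · rintro ⟨hf, hc⟩
    exact ⟨hf.1, hc⟩

end EvenSimplex

/-! ### Counting thin triangles and all triangles -/

theorem card_le_of_sub_le {S : Finset ℤ} {r : ℕ} (h : ∀ x ∈ S, ∀ y ∈ S, x - y ≤ r) :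
    S.card ≤ r + 1 := by
  rcases S.eq_empty_or_nonempty with rfl | hS
  · simp
  have hsub : S ⊆ Finset.Icc (S.min' hS) (S.min' hS + r) := fun x hx => by
    have := h x hx _ (S.min'_mem hS)
    exact Finset.mem_Icc.2 ⟨S.min'_le x hx, by omega⟩
  refine (Finset.card_le_card hsub).trans ?_
  rw [Int.card_Icc]
  omega

/-- A set of tuples has few elements if one coordinate takes values in short intervals when the
others are fixed. -/
theorem card_le_of_fiber {α β : Type*} [DecidableEq β] (S : Finset α) (B : Finset β) (f : α → β)
    (g : α → ℤ) (hf : ∀ x ∈ S, f x ∈ B) (hfg : ∀ x ∈ S, ∀ y ∈ S, f x = f y → g x = g y → x = y)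
    {r : ℕ} (hr : ∀ x ∈ S, ∀ y ∈ S, f x = f y → g x - g y ≤ r) : S.card ≤ (r + 1) * B.card := by
  refine Finset.card_le_mul_card_image_of_maps_to hf _ fun b _ => ?_
  rw [← Finset.card_image_of_injOn (f := g)]
  · refine card_le_of_sub_le fun u hu v hv => ?_
    obtain ⟨x, hx, rfl⟩ := Finset.mem_image.1 hu
    obtain ⟨y, hy, rfl⟩ := Finset.mem_image.1 hv
    rw [Finset.mem_filter] at hx hy
    exact hr x hx.1 y hy.1 (hx.2.trans hy.2.symm)
  · intro x hx y hy hxy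
    have hx' := Finset.mem_filter.1 hx
    have hy' := Finset.mem_filter.1 hy
    exact hfg x hx'.1 y hy'.1 (hx'.2.trans hy'.2.symm) hxy

/-- Triples of points of `[0, d]²` spanning a triangle of area at most `d + 1/2`. -/
noncomputable def thinTriples (d : ℕ) : Finset ((Fin 2 → ℤ) × (Fin 2 → ℤ) × (Fin 2 → ℤ)) :=
  ((Fintype.piFinset fun _ => Finset.Icc 0 (d : ℤ)) ×ˢ (Fintype.piFinset fun _ => Finset.Icc 0 (d : ℤ))
    ×ˢ (Fintype.piFinset fun _ => Finset.Icc 0 (d : ℤ))).filter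
    fun x => |orient x.1 x.2.1 x.2.2| ≤ 2 * d + 1

theorem mem_thinTriples {d : ℕ} {x : (Fin 2 → ℤ) × (Fin 2 → ℤ) × (Fin 2 → ℤ)} :
    x ∈ thinTriples d ↔ ((∀ i, 0 ≤ x.1 i ∧ x.1 i ≤ d) ∧ (∀ i, 0 ≤ x.2.1 i ∧ x.2.1 i ≤ d) ∧
      (∀ i, 0 ≤ x.2.2 i ∧ x.2.2 i ≤ d)) ∧ |orient x.1 x.2.1 x.2.2| ≤ 2 * d + 1 := by
  simp [thinTriples, Fintype.mem_piFinset]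

/-- If the first two points differ horizontally by less than K, few values remain for that
coordinate. Otherwise the determinant has slope at least K in absolute value in the last coordinate
of the third point. -/
theorem card_thinTriples_le (d K : ℕ) (hK : 0 < K) :
    (thinTriples d).card ≤ (2 * K + ((4 * d + 2) / K + 1)) * (d + 1) ^ 5 := by
  classical
  let I := Finset.Icc 0 (d : ℤ)
  have hI : I.card = d + 1 := by simp [I]
  let B : Finset (ℤ × ℤ × ℤ × ℤ × ℤ) := I ×ˢ I ×ˢ I ×ˢ I ×ˢ I
  have hB : B.card = (d + 1) ^ 5 := by
    simp only [B, Finset.card_product, hI]; ring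
  have split := Finset.card_filter_add_card_filter_not (s := thinTriples d)
    (fun x => |x.2.1 0 - x.1 0| < (K : ℤ))
  have ext2 : ∀ u v : Fin 2 → ℤ, u 0 = v 0 → u 1 = v 1 → u = v := fun u v h0 h1 => by
    ext i; fin_cases i <;> assumption
  have c1 : ((thinTriples d).filter fun x => |x.2.1 0 - x.1 0| < (K : ℤ)).card ≤
      (2 * K - 1 + 1) * (d + 1) ^ 5 := by
    rw [← hB]
    refine card_le_of_fiber _ B (fun x => (x.1 0, x.1 1, x.2.1 1, x.2.2 0, x.2.2 1))
      (fun x => x.2.1 0) ?_ ?_ ?_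
    · intro x hx
      obtain ⟨⟨h1, h2, h3⟩, -⟩ := mem_thinTriples.1 (Finset.mem_filter.1 hx).1
      simp only [B, I, Finset.mem_product, Finset.mem_Icc]
      exact ⟨h1 0, h1 1, h2 1, h3 0, h3 1⟩
    · rintro ⟨x1, x2, x3⟩ - ⟨y1, y2, y3⟩ - h h'
      simp only [Prod.mk.injEq] at h h' ⊢
      exact ⟨ext2 _ _ h.1 h.2.1, ext2 _ _ h' h.2.2.1, ext2 _ _ h.2.2.2.1 h.2.2.2.2⟩
    · intro x hx y hy h
      have hx' := abs_lt.1 (Finset.mem_filter.1 hx).2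
      have hy' := abs_lt.1 (Finset.mem_filter.1 hy).2
      simp only [Prod.mk.injEq] at h
      omega
  have c2 : ((thinTriples d).filter fun x => ¬ |x.2.1 0 - x.1 0| < (K : ℤ)).card ≤
      ((4 * d + 2) / K + 1) * (d + 1) ^ 5 := by
    rw [← hB]
    refine card_le_of_fiber _ B (fun x => (x.1 0, x.1 1, x.2.1 0, x.2.1 1, x.2.2 0))
      (fun x => x.2.2 1) ?_ ?_ ?_
    · intro x hx
      obtain ⟨⟨h1, h2, h3⟩, -⟩ := mem_thinTriples.1 (Finset.mem_filter.1 hx).1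
      simp only [B, I, Finset.mem_product, Finset.mem_Icc]
      exact ⟨h1 0, h1 1, h2 0, h2 1, h3 0⟩
    · rintro ⟨x1, x2, x3⟩ - ⟨y1, y2, y3⟩ - h h'
      simp only [Prod.mk.injEq] at h h' ⊢
      exact ⟨ext2 _ _ h.1 h.2.1, ext2 _ _ h.2.2.1 h.2.2.2.1, ext2 _ _ h.2.2.2.2 h'⟩
    · rintro ⟨a, b, c⟩ hx ⟨a', b', c'⟩ hy h
      obtain ⟨hx1, hx2⟩ := Finset.mem_filter.1 hx
      have hx3 := abs_le.1 (mem_thinTriples.1 hx1).2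
      have hy3 := abs_le.1 (mem_thinTriples.1 (Finset.mem_filter.1 hy).1).2
      simp only [Prod.mk.injEq] at h
      obtain ⟨e1, e2, e3, e4, e5⟩ := h
      simp only [orient, ← e1, ← e2, ← e3, ← e4, ← e5] at hx2 hx3 hy3 ⊢
      push_cast
      -- Two determinants in [-(2d + 1), 2d + 1] differ by at most 4d + 2.
      rw [Int.le_ediv_iff_mul_le (by omega)]
      by_contra! hlt
      have hpos : 0 < c 1 - c' 1 := by
        by_contra hle
        nlinarith
      have hmul : (c 1 - c' 1) * K ≤ (c 1 - c' 1) * |b 0 - a 0| :=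
        mul_le_mul_of_nonneg_left (not_lt.1 hx2) hpos.le
      rcases abs_cases (b 0 - a 0) with ⟨h1, -⟩ | ⟨h1, -⟩ <;> rw [h1] at hmul <;> linarith
  calc (thinTriples d).card ≤ (2 * K - 1 + 1) * (d + 1) ^ 5 + ((4 * d + 2) / K + 1) * (d + 1) ^ 5 := by
        omega
    _ = _ := by
        rw [← add_mul]
        congr 2
        omega

/-- K of order √d balances the two contributions: 2K + 4K + 1 ≤ 7K. -/
theorem card_thinTriples_le_sqrt (d : ℕ) :
    (thinTriples d).card ≤ 7 * (Nat.sqrt d + 1) * (d + 1) ^ 5 := by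
  refine (card_thinTriples_le d (Nat.sqrt d + 1) (Nat.succ_pos _)).trans ?_
  refine Nat.mul_le_mul_right _ ?_
  have h := Nat.lt_succ_sqrt d
  set K := Nat.sqrt d + 1 with hK
  have h1 : d < K * K := h
  have : (4 * d + 2) / K ≤ 4 * K := by
    refine Nat.div_le_of_le_mul ?_
    nlinarith
  omega

theorem affineIndependent_of_det_ne_zero {p : Fin 3 → Fin 2 → ℝ}
    (h : (p 1 0 - p 0 0) * (p 2 1 - p 0 1) - (p 1 1 - p 0 1) * (p 2 0 - p 0 0) ≠ 0) :
    AffineIndependent ℝ p := by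
  rw [affineIndependent_iff_of_fintype]
  intro w hw hwp
  rw [Finset.weightedVSub_eq_linear_combination _ hw, Fin.sum_univ_three] at hwp
  rw [Fin.sum_univ_three] at hw
  have h0 := congrFun hwp 0
  have h1 := congrFun hwp 1
  simp only [Pi.add_apply, Pi.smul_apply, smul_eq_mul, Pi.zero_apply] at h0 h1
  have w1 : w 1 = 0 := by
    refine (mul_eq_zero.1 ?_).resolve_right h
    linear_combination (p 2 1 - p 0 1) * h0 - (p 2 0 - p 0 0) * h1
      + (p 0 1 * (p 2 0 - p 0 0) - p 0 0 * (p 2 1 - p 0 1)) * hw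
  have w2 : w 2 = 0 := by
    refine (mul_eq_zero.1 ?_).resolve_right h
    linear_combination (p 1 0 - p 0 0) * h1 - (p 1 1 - p 0 1) * h0
      + (p 0 0 * (p 1 1 - p 0 1) - p 0 1 * (p 1 0 - p 0 0)) * hw
  intro i
  fin_cases i
  · simp only [Fin.zero_eta]; linarith
  · exact w1
  · exact w2

namespace EvenSimplex

/-- The halved vertices of an even triangle. -/
def halfVertices (Δ : EvenSimplex 2) : (Fin 2 → ℤ) × (Fin 2 → ℤ) × (Fin 2 → ℤ) :=
  (Δ.halfVertex 0, Δ.halfVertex 1, Δ.halfVertex 2)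

theorem halfVertices_injective : Function.Injective halfVertices := by
  intro Δ Δ' h
  simp only [halfVertices, Prod.mk.injEq] at h
  have key : ∀ j, Δ.halfVertex j = Δ'.halfVertex j := by
    intro j; fin_cases j
    exacts [h.1, h.2.1, h.2.2]
  ext j i
  have h1 := congrFun (Δ.two_smul_halfVertex j) i
  have h2 := congrFun (Δ'.two_smul_halfVertex j) i
  rw [key j, h2] at h1
  simpa [toInt] using h1.symm

theorem halfVertex_mem_of_ofDegree {Δ : EvenSimplex 2} {d : ℕ} (hd : Δ ∈ ofDegree 2 d)
    (j : Fin 3) (i : Fin 2) : 0 ≤ Δ.halfVertex j i ∧ Δ.halfVertex j i ≤ d := by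
  have := hd j
  rw [Fin.sum_univ_two] at this
  simp only [halfVertex]
  fin_cases i <;> simp <;> omega

theorem finite_ofDegree (d : ℕ) : (ofDegree 2 d).Finite := by
  let J : Set (Fin 2 → ℤ) := Set.Icc 0 fun _ => (d : ℤ)
  have hJ : J.Finite := Set.finite_Icc _ _
  refine Set.Finite.of_injOn (f := halfVertices) (t := J ×ˢ J ×ˢ J) (fun Δ hΔ => ?_)
    halfVertices_injective.injOn (hJ.prod (hJ.prod hJ))
  have h := fun j i => halfVertex_mem_of_ofDegree hΔ j i
  exact ⟨⟨fun i => (h 0 i).1, fun i => (h 0 i).2⟩, ⟨fun i => (h 1 i).1, fun i => (h 1 i).2⟩,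
    ⟨fun i => (h 2 i).1, fun i => (h 2 i).2⟩⟩

theorem ncard_thin_le (d : ℕ) {S : Set (EvenSimplex 2)} (hS : S ⊆ ofDegree 2 d)
    (h : ∀ Δ ∈ S, |Δ.halfOrient| ≤ 2 * d + 1) :
    S.ncard ≤ 7 * (Nat.sqrt d + 1) * (d + 1) ^ 5 := by
  refine le_trans ?_ (card_thinTriples_le_sqrt d)
  rw [← Set.ncard_coe_finset]
  refine Set.ncard_le_ncard_of_injOn halfVertices (fun Δ hΔ => ?_) halfVertices_injective.injOn
    (Finset.finite_toSet _)
  have hm := halfVertex_mem_of_ofDegree (hS hΔ)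
  exact Finset.mem_coe.2 (mem_thinTriples.2 ⟨⟨hm 0, hm 1, hm 2⟩, h Δ hΔ⟩)

/-- An even triangle with vertices near three given points in general position. -/
noncomputable def ofFin (m : ℕ) (x : Fin 3 → Fin 2 → Fin (m + 1)) : EvenSimplex 2 where
  vertex j := Finsupp.equivFunOnFinite.symm fun i =>
    -- The half vertices range over boxes of side m at (0, 0), (2m + 1, 0) and (0, 2m + 1). The
    -- offset 2m + 1 makes the determinant at least (m + 1)² - m² > 0.
    2 * ((x j i : ℕ) + if (j = 1 ∧ i = 0) ∨ (j = 2 ∧ i = 1) then 2 * m + 1 else 0)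
  even j i := by simp
  affineIndependent := by
    apply affineIndependent_of_det_ne_zero
    have h : ∀ j i, (0 : ℝ) ≤ (x j i : ℕ) ∧ ((x j i : ℕ) : ℝ) ≤ m := fun j i =>
      ⟨Nat.cast_nonneg _, by exact_mod_cast Nat.lt_succ_iff.1 (x j i).2⟩
    simp [toReal, toInt]
    have h00 := h 0 0
    have h01 := h 0 1
    have h10 := h 1 0
    have h11 := h 1 1
    have h20 := h 2 0
    have h21 := h 2 1
    generalize ((x 0 0 : ℕ) : ℝ) = a0 at *
    generalize ((x 0 1 : ℕ) : ℝ) = a1 at *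
    generalize ((x 1 0 : ℕ) : ℝ) = b0 at *
    generalize ((x 1 1 : ℕ) : ℝ) = b1 at *
    generalize ((x 2 0 : ℕ) : ℝ) = c0 at *
    generalize ((x 2 1 : ℕ) : ℝ) = c1 at *
    have hm : (0 : ℝ) ≤ m := Nat.cast_nonneg _
    have p1 : (m + 1 : ℝ) * (m + 1) ≤ (b0 + (2 * m + 1) - a0) * (c1 + (2 * m + 1) - a1) :=
      mul_le_mul (by linarith) (by linarith) (by linarith) (by linarith)
    have p2 : (b1 - a1) * (c0 - a0) ≤ m * m := by
      refine (le_abs_self _).trans ?_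
      rw [abs_mul]
      refine mul_le_mul ?_ ?_ (abs_nonneg _) hm <;> rw [abs_le] <;> constructor <;> linarith
    intro h0
    nlinarith

/-- The coordinate sum of a half vertex of `ofFin` is at most 2m + (2m + 1), and the six coordinates
are free. -/
theorem pow_le_ncard_ofDegree {m d : ℕ} (h : 4 * m + 1 ≤ d) :
    (m + 1) ^ 6 ≤ (ofDegree 2 d).ncard := by
  have : (m + 1) ^ 6 = (Set.univ : Set (Fin 3 → Fin 2 → Fin (m + 1))).ncard := by
    rw [Set.ncard_univ, Nat.card_eq_fintype_card]
    simp [← pow_mul]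
  rw [this]
  refine Set.ncard_le_ncard_of_injOn (ofFin m) (fun x _ j => ?_) ?_ (finite_ofDegree d)
  · have h1 : ∀ j i, (x j i : ℕ) ≤ m := fun j i => Nat.lt_succ_iff.1 (x j i).2
    have := h1 j 0
    have := h1 j 1
    fin_cases j <;> simp_all [ofFin, Fin.sum_univ_two] <;> omega
  · intro x _ y _ hxy
    ext j i
    have := congrArg (fun Δ => Δ.vertex j i) hxy
    simpa [ofFin] using this

theorem ncard_ofDegree_ge {d : ℕ} (hd : 1 ≤ d) : (d : ℝ) ^ 6 / 4 ^ 6 ≤ (ofDegree 2 d).ncard := by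
  have h1 := pow_le_ncard_ofDegree (m := (d - 1) / 4) (d := d) (by omega)
  have h2 : d ≤ 4 * ((d - 1) / 4 + 1) := by omega
  have h3 : (d : ℝ) / 4 ≤ (((d - 1) / 4 + 1 : ℕ) : ℝ) := by
    have : (d : ℝ) ≤ 4 * (((d - 1) / 4 + 1 : ℕ) : ℝ) := by exact_mod_cast h2
    linarith
  calc (d : ℝ) ^ 6 / 4 ^ 6 = ((d : ℝ) / 4) ^ 6 := by rw [div_pow]
    _ ≤ (((d - 1) / 4 + 1 : ℕ) : ℝ) ^ 6 := by gcongr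
    _ ≤ _ := by exact_mod_cast h1

end EvenSimplex

/-! ### Density -/

open EvenSimplex in
/-- A property of all even triangles of large area holds for almost all even triangles. -/
theorem almostAllEvenSimplices_of_area {Q : EvenSimplex 2 → Prop}
    (h : ∀ (d : ℕ) (Δ : EvenSimplex 2), Δ ∈ ofDegree 2 d → 2 * (d : ℤ) + 1 < |Δ.halfOrient| → Q Δ) :
    AlmostAllEvenSimplices 2 Q := by
  -- The constant combines the thin count, with √d + 1 ≤ 2√d and d + 1 ≤ 2d, and the lower bound
  -- d⁶/4⁶ for all triangles.
  have hlim : Filter.Tendsto (fun d : ℕ => 1 - 7 * 2 * 2 ^ 5 * 4 ^ 6 / Real.sqrt d) Filter.atTop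
      (nhds 1) := by
    have h1 : Filter.Tendsto (fun d : ℕ => Real.sqrt d) Filter.atTop Filter.atTop :=
      Real.tendsto_sqrt_atTop.comp tendsto_natCast_atTop_atTop
    simpa using (h1.const_div_atTop (7 * 2 * 2 ^ 5 * 4 ^ 6)).const_sub 1
  refine tendsto_of_tendsto_of_tendsto_of_le_of_le' hlim tendsto_const_nhds ?_ ?_
  · filter_upwards [Filter.eventually_ge_atTop 1] with d hd
    have hsplit := Set.ncard_inter_add_ncard_sdiff_eq_ncard (ofDegree 2 d) {Δ | Q Δ}
      (finite_ofDegree d)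
    have hthin := ncard_thin_le d (S := ofDegree 2 d \ {Δ | Q Δ}) Set.sdiff_subset
      (fun Δ hΔ => by
        by_contra! hlt
        exact hΔ.2 (h d Δ hΔ.1 hlt))
    have hge := ncard_ofDegree_ge hd
    set N := (ofDegree 2 d).ncard
    set g := (ofDegree 2 d ∩ {Δ | Q Δ}).ncard
    set t := (ofDegree 2 d \ {Δ | Q Δ}).ncard
    have hd1 : (1 : ℝ) ≤ d := by exact_mod_cast hd
    have hN : (0 : ℝ) < N := lt_of_lt_of_le (by positivity) hge
    have hsplit' : (g : ℝ) + t = N := by exact_mod_cast hsplit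
    have hs1 : 1 ≤ Real.sqrt d := Real.one_le_sqrt.2 hd1
    have hsq : Real.sqrt d * Real.sqrt d = d := Real.mul_self_sqrt (by linarith)
    have hK : ((Nat.sqrt d : ℕ) : ℝ) ≤ Real.sqrt d := Real.nat_sqrt_le_real_sqrt
    have ht : (t : ℝ) ≤ 7 * (2 * Real.sqrt d) * (2 * d) ^ 5 := by
      calc (t : ℝ) ≤ 7 * ((Nat.sqrt d : ℕ) + 1) * (d + 1) ^ 5 := by exact_mod_cast hthin
        _ ≤ _ := by
          gcongr
          · linarith
          · linarith
    have key : (t : ℝ) ≤ 7 * 2 * 2 ^ 5 * 4 ^ 6 / Real.sqrt d * N := by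
      refine ht.trans ?_
      calc 7 * (2 * Real.sqrt d) * (2 * d) ^ 5
          = 7 * 2 * 2 ^ 5 * 4 ^ 6 / Real.sqrt d * ((d : ℝ) ^ 6 / 4 ^ 6) := by
            have : Real.sqrt d ≠ 0 := by positivity
            field_simp
            rw [Real.sq_sqrt (by linarith)]
        _ ≤ _ := by gcongr
    rw [le_div_iff₀ hN]
    linarith
  · refine Filter.Eventually.of_forall fun d => ?_
    refine div_le_one_of_le₀ ?_ (Nat.cast_nonneg _)
    exact_mod_cast Set.ncard_le_ncard Set.inter_subset_left (finite_ofDegree d)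

theorem mainTheorem10 :
    (∀ Δ : EvenSimplex 2, 4 ≤ Δ.halfBoundaryPoints.encard →
      Δ.IsHSimplex ∧ Δ.NonnegEqSOS) ∧
    AlmostAllEvenSimplices 2 (fun Δ => Δ.IsHSimplex) ∧
    AlmostAllEvenSimplices 2 (fun Δ => Δ.NonnegEqSOS) :=
  ⟨fun Δ h => ⟨Δ.isHSimplex_of_boundary h, (Δ.isHSimplex_of_boundary h).nonnegEqSOS⟩,
    almostAllEvenSimplices_of_area fun _ Δ hd h => Δ.isHSimplex_of_area hd h,
    almostAllEvenSimplices_of_area fun _ Δ hd h => (Δ.isHSimplex_of_area hd h).nonnegEqSOS⟩
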